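/- **Setting.** Let $d\ge 1$, $T\ge 2$, $\mathcal X\subseteq\mathbb R^d$, $\theta_\star\in\mathbb R^d$. In round $t=1,\dots,T$ an agent chooses an arm $x_t\in\mathcal X$, using only its past observations (and possibly private randomization), and observes $y_t=\langle x_t,\theta_\star\rangle+\eta_t$ with i.i.d. noise $\eta_t\sim N(0,\sigma^2)$, $\sigma>0$. Let $x_\star$ maximize $\langle x,\theta_\star\rangle$ over $\mathcal X$ (assumed to exist) and let $\mathbf R_T=\mathbb E\big[\sum_{t=1}^T\langle x_\star-x_t,\theta_\star\rangle\big]$ be the regret. Permutations of $[d]=\{1,\dots,d\}$ act on $\mathbb R^d$ by permuting coordinates. Let $\mathcal G\le\mathcal S_d$ be a hidden group with $g\cdot\theta_\star=\theta_\star$ for all $g\in\mathcal G$, and let $\pi_{\mathcal G}$ be the partition of $[d]$ into $\mathcal G$-orbits. Let $\mathcal Q\ni\pi_{\mathcal G}$ be a collection of partitions of $[d]$ with at most $d_0$ classes, let $\mathcal M$ be the collection of subspaces $\mathrm{Fix}_{\mathcal H}=\{x: g\cdot x=x\ \forall g\in \mathcal H\}$ over the groups $\mathcal H\le\mathcal S_d$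 with $\pi_{\mathcal H}\in\mathcal Q$, and let $\overline{\mathcal M}=\{\mathrm{conv}(m\cup m'):m,m'\in\mathcal M\}$. Write $\Pi_m$ for the orthogonal projection onto $m$. **Assumptions.** (1) For constants $A,c$ and every $1\le k\le d_0$, at most $A\,d^{ck}$ partitions in $\mathcal Q$ have exactly $k$ classes. (2) There are $K_x\ge1$ and $R>0$ with $\|\Pi_m x\|^2\le K_x$ and $|\langle x,\theta_\star\rangle|\le R$ for all $x\in\mathcal X$, $m\in\overline{\mathcal M}$. (3) There is $\varepsilon_0>0$ with $|\theta_{\star,i}-\theta_{\star,j}|\ge\varepsilon_0$ whenever $i,j$ lie in different classes of $\pi_{\mathcal G}$. (4) $\nu$ maximizes $\lambda_{\min}(\mathbb E_{x\sim\omega}[xx^\top])$ over the probability measures $\omega$ supported on $\mathcal X$, and its value $C_{\min}=\lambda_{\min}(\mathbb E_{x\sim\nu}[xx^\top])$ is positive. (5) $\varepsilon_0\le\kappa\sigma$ for a constant $\kappa$. **Algorithm.** For $t\le t_2$ (where $t_2\le T$), draw $x_t$ i.i.d. from $\nu$. With $Y=(y_t)_{t\le t_2}$ and $S_m$ the column space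 of $[\Pi_m x_1,\dots,\Pi_m x_{t_2}]^\top$, select $\widehat m\in\arg\min_{m\in\mathcal M}\|Y-\Pi_{S_m}Y\|^2$ (ties broken in any non-anticipating way). In rounds $t_2+1,\dots,T$ play OFUL on $\widehat m$, started afresh, with confidence parameter $\delta=1/T$, regularization $\lambda>0$ and norm bound $S$: with $z_s=\Pi_{\widehat m}x_s$, $V=\lambda I+\sum_s z_sz_s^\top$, $\widehat\theta=V^{-1}\sum_s y_sz_s$ (sums over $t_2<s<t$), choose $x_t$ so that $(x_t,\tilde\theta_t)$, for some $\tilde\theta_t$, maximizes $\langle x,\theta\rangle$ over $x\in\mathcal X$ and $\theta\in\widehat m$ with $$\|\theta-\widehat\theta\|_V\le\sigma\sqrt{2\log\big(\det(V)^{1/2}\det(\lambda I)^{-1/2}/\delta\big)}+\sqrt\lambda\,S .$$ The tuning of $(\lambda,S)$ satisfies $\|\theta_\star\|\le S$, $\sqrt\lambda\,S\le\kappa\sigma$ and $\sigma^2C_{\min}\le\kappa\lambda R^2$; for instance, if $\kappa\ge1$, $\lambda=\sigma^2C_{\min}/R^2$ and $S=R/\sqrt{C_{\min}}$. **Theorem.**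 Put $$E=\frac{\sigma^2K_x^2d_0\log(dT)}{C_{\min}^2\varepsilon_0^2}.$$ There is $c_1>0$, depending only on $A,c,\kappa$, such that if $t_2\ge c_1E$, then $\theta_\star\in\widehat m$ with probability at least $1-1/T$ (whatever is played after round $t_2$). Moreover, for every $c_2$ there is $C$, depending only on $A,c,\kappa,c_2$, such that if $c_1E\le t_2\le c_2E$, then $$\mathbf R_T\le C\Big(\frac{R\,\sigma^2K_x^2d_0\log(dT)}{C_{\min}^2\varepsilon_0^2}+\sigma d_0\sqrt T\,\log(K_xT)\Big).$$ -/

import Mathlib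

open MeasureTheory ProbabilityTheory

noncomputable section

namespace SymBandit

/-- The Euclidean space of dimension `n`. -/
abbrev Vec (n : ℕ) := EuclideanSpace ℝ (Fin n)

/-! ### Permutation groups, partitions and fixed-point subspaces -/

/-- The action of a permutation on a vector: `g · x = (x_{g(i)})_i`. -/
def permute {d : ℕ} (g : Equiv.Perm (Fin d)) (x : Vec d) : Vec d :=
  WithLp.toLp 2 (fun i => x (g i))

/-- The fixed-point subspace `{x | g · x = x for all g ∈ G}`. -/
def fixedSubspace {d : ℕ} (G : Subgroup (Equiv.Perm (Fin d))) : Submodule ℝ (Vec d) where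
  carrier := {x | ∀ g ∈ G, permute g x = x}
  zero_mem' := by
    intro g _
    ext i
    simp [permute]
  add_mem' := by
    intro x y hx hy g hg
    ext i
    have h1 := congrArg (fun v : Vec d => v i) (hx g hg)
    have h2 := congrArg (fun v : Vec d => v i) (hy g hg)
    simp only [permute] at h1 h2
    simp only [permute, PiLp.add_apply]
    rw [h1, h2]
  smul_mem' := by
    intro a x hx g hg
    ext i
    have h1 := congrArg (fun v : Vec d => v i) (hx g hg)
    simp only [permute] at h1
    simp only [permute, PiLp.smul_apply]
    rw [h1]

/-- The partition of the index set into the orbits of `G`. -/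
def orbitPartition {d : ℕ} (G : Subgroup (Equiv.Perm (Fin d))) : Setoid (Fin d) :=
  MulAction.orbitRel G (Fin d)

/-- The fixed-point subspace depends only on the orbit partition: it consists of the vectors
that are constant on every orbit. -/
theorem mem_fixedSubspace_iff {d : ℕ} (G : Subgroup (Equiv.Perm (Fin d))) (x : Vec d) :
    x ∈ fixedSubspace G ↔ ∀ i j, orbitPartition G i j → x i = x j := by
  constructor
  · rintro h i j ⟨g, hg⟩
    have h1 := congrArg (fun v : Vec d => v j) (h g.1 g.2)
    simp only [permute] at h1
    rw [← h1, ← hg]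
    rfl
  · intro h g hg
    ext i
    exact h (g i) i ⟨⟨g, hg⟩, rfl⟩

/-- The number of classes of a partition. -/
def numClasses {d : ℕ} (p : Setoid (Fin d)) : ℕ := Nat.card (Quotient p)

/-- The collection of models that belongs to a collection `Q` of partitions: the fixed-point
subspaces of the permutation groups whose orbit partition lies in `Q`. -/
def models {d : ℕ} (Q : Set (Setoid (Fin d))) : Set (Submodule ℝ (Vec d)) :=
  {m | ∃ H : Subgroup (Equiv.Perm (Fin d)), orbitPartition H ∈ Q ∧ m = fixedSubspace H}

/-- The extended collection: the subspaces `conv (m ∪ m') = m + m'` with `m`, `m'` models. -/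
def extendedModels {d : ℕ} (Q : Set (Setoid (Fin d))) : Set (Submodule ℝ (Vec d)) :=
  {n | ∃ m ∈ models Q, ∃ m' ∈ models Q, n = m ⊔ m'}

/-- The convex hull of the union of two subspaces is their sum. -/
theorem convexHull_union_submodule {d : ℕ} (m m' : Submodule ℝ (Vec d)) :
    convexHull ℝ ((m : Set (Vec d)) ∪ m') = (m ⊔ m' : Submodule ℝ (Vec d)) := by
  apply Set.Subset.antisymm
  · apply convexHull_min
    · rintro x (hx | hx)
      · exact Submodule.mem_sup_left hx
      · exact Submodule.mem_sup_right hx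
    · exact Submodule.convex _
  · intro x hx
    obtain ⟨y, hy, z, hz, rfl⟩ := Submodule.mem_sup.1 hx
    have h1 : (2 : ℝ) • y ∈ convexHull ℝ ((m : Set (Vec d)) ∪ m') :=
      subset_convexHull ℝ _ (Or.inl (m.smul_mem 2 hy))
    have h2 : (2 : ℝ) • z ∈ convexHull ℝ ((m : Set (Vec d)) ∪ m') :=
      subset_convexHull ℝ _ (Or.inr (m'.smul_mem 2 hz))
    have h3 := (convex_convexHull ℝ ((m : Set (Vec d)) ∪ m')) h1 h2
      (a := 1 / 2) (b := 1 / 2) (by norm_num) (by norm_num) (by norm_num)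
    simpa [smul_smul] using h3

/-- Sub-exponential number of partitions: all partitions in `Q` have at most `d₀` classes, and
at most `A d ^ (c k)` of them have exactly `k` classes. -/
def SubexponentialPartitions {d : ℕ} (Q : Set (Setoid (Fin d))) (d₀ : ℕ) (A c : ℝ) : Prop :=
  (∀ p ∈ Q, numClasses p ≤ d₀) ∧
    ∀ k : ℕ, 1 ≤ k → k ≤ d₀ →
      (({p ∈ Q | numClasses p = k}.ncard : ℕ) : ℝ) ≤ A * (d : ℝ) ^ (c * (k : ℝ))

/-- Well-separatedness: coordinates of `θ` in different orbits of `G` differ by at least `ε`. -/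
def WellSeparated {d : ℕ} (G : Subgroup (Equiv.Perm (Fin d))) (θ : Vec d) (ε : ℝ) : Prop :=
  ∀ i j, ¬ orbitPartition G i j → ε ≤ |θ i - θ j|

/-! ### Arms and the exploratory distribution -/

/-- Boundedness of the arms: `‖Π_m x‖² ≤ K` on every extended model, and `|⟨x, θ⟩| ≤ R`. -/
def BoundedArms {d : ℕ} (X : Set (Vec d)) (Q : Set (Setoid (Fin d))) (θ : Vec d) (K R : ℝ) :
    Prop :=
  ∀ x ∈ X, (∀ m ∈ extendedModels Q, ‖m.starProjection x‖ ^ 2 ≤ K) ∧ |inner ℝ x θ| ≤ R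

/-- The second-moment matrix `E_{x ∼ ω}[x xᵀ]`. -/
def secondMoment {d : ℕ} (ω : Measure (Vec d)) : Matrix (Fin d) (Fin d) ℝ :=
  fun i j => ∫ x, x i * x j ∂ω

/-- The smallest eigenvalue of a symmetric matrix, as the minimum of the Rayleigh quotient. -/
def lamMin {d : ℕ} (B : Matrix (Fin d) (Fin d) ℝ) : ℝ :=
  ⨅ v : Metric.sphere (0 : Vec d) 1, (v : Vec d).ofLp ⬝ᵥ (B.mulVec (v : Vec d).ofLp)

/-- `ω` is a probability measure supported on `X`. -/
def IsDistOn {d : ℕ} (X : Set (Vec d)) (ω : Measure (Vec d)) : Prop :=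
  IsProbabilityMeasure ω ∧ ω Xᶜ = 0

/-- `ν` is an exploratory distribution: it maximizes `λ_min(E[x xᵀ])` among the probability
measures supported on `X`. -/
def IsExploratory {d : ℕ} (X : Set (Vec d)) (ν : Measure (Vec d)) : Prop :=
  IsDistOn X ν ∧ ∀ ω : Measure (Vec d), IsDistOn X ω →
    lamMin (secondMoment ω) ≤ lamMin (secondMoment ν)

/-! ### The interaction -/

/-- The noise `η_t = y_t - ⟨x_t, θ⟩`. -/
def noise {d : ℕ} {Ω : Type*} (θ : Vec d) (arm : ℕ → Ω → Vec d) (reward : ℕ → Ω → ℝ)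
    (t : ℕ) (ω : Ω) : ℝ :=
  reward t ω - inner ℝ (arm t ω) θ

/-- The σ-algebra of the observations made before round `t`. -/
abbrev history {d : ℕ} {Ω : Type*} (arm : ℕ → Ω → Vec d) (reward : ℕ → Ω → ℝ) (t : ℕ) :
    MeasurableSpace Ω :=
  ⨆ s : Fin t, (MeasurableSpace.comap (arm s) inferInstance ⊔
    MeasurableSpace.comap (reward s) inferInstance)

/-- A linear bandit interaction over the rounds `0, …, T - 1`. The σ-algebra `ℱ t` is what the
agent knows when arm `t` has been chosen (the past, its own randomization and the arm `t`);
the rewards are `y_t = ⟨x_t, θ⟩ + η_t` with independent noise `η_t ∼ N(0, σ²)`. -/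
structure IsInteraction {d : ℕ} {Ω : Type*} [mΩ : MeasurableSpace Ω] (μ : Measure Ω)
    (ℱ : Filtration ℕ mΩ) (X : Set (Vec d)) (θ : Vec d) (σ : ℝ) (T : ℕ)
    (arm : ℕ → Ω → Vec d) (reward : ℕ → Ω → ℝ) : Prop where
  arm_mem : ∀ t < T, ∀ ω, arm t ω ∈ X
  arm_meas : ∀ t < T, Measurable[ℱ t] (arm t)
  reward_meas : ∀ t < T, Measurable[ℱ (t + 1)] (reward t)
  noise_law : ∀ t < T, μ.map (noise θ arm reward t) = gaussianReal 0 (σ ^ 2).toNNReal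
  noise_indep : ∀ t < T,
    Indep (MeasurableSpace.comap (noise θ arm reward t) inferInstance) (ℱ t) μ

/-! ### Model selection -/

/-- The column space of `X_m = [Π_m x_1, …, Π_m x_n]ᵀ`, that is, `{X_m θ | θ ∈ ℝᵈ} ⊆ ℝⁿ`. -/
def colSpace {d n : ℕ} (m : Submodule ℝ (Vec d)) (x : Fin n → Vec d) : Submodule ℝ (Vec n) :=
  Submodule.span ℝ (Set.range fun j : Fin d =>
    (WithLp.toLp 2 (fun t : Fin n => m.starProjection (x t) j) : Vec n))

/-- The squared residual `‖Y - Π_{S_m} Y‖²` of the model `m`. -/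
def residual {d n : ℕ} (m : Submodule ℝ (Vec d)) (x : Fin n → Vec d) (y : Fin n → ℝ) : ℝ :=
  ‖(WithLp.toLp 2 y : Vec n) - (colSpace m x).starProjection (WithLp.toLp 2 y)‖ ^ 2

/-- `m` minimizes the squared residual over the collection of models. -/
def IsSelected {d n : ℕ} (Q : Set (Setoid (Fin d))) (x : Fin n → Vec d) (y : Fin n → ℝ)
    (m : Submodule ℝ (Vec d)) : Prop :=
  m ∈ models Q ∧ ∀ m' ∈ models Q, residual m x y ≤ residual m' x y

/-- Rounds `0, …, t₂ - 1`: the arms are drawn from `ν` independently of all that has been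
observed before; afterwards a model `mhat` is selected from the exploration data, ties being
broken in any (possibly randomized) way that does not look into the future. -/
structure ExploresAndSelects {d : ℕ} {Ω : Type*} [mΩ : MeasurableSpace Ω] (μ : Measure Ω)
    (ℱ : Filtration ℕ mΩ) (Q : Set (Setoid (Fin d))) (ν : Measure (Vec d)) (t₂ : ℕ)
    (arm : ℕ → Ω → Vec d) (reward : ℕ → Ω → ℝ) (mhat : Ω → Submodule ℝ (Vec d)) : Prop where
  arm_law : ∀ t < t₂, μ.map (arm t) = ν
  arm_indep : ∀ t < t₂,
    Indep (MeasurableSpace.comap (arm t) inferInstance) (history arm reward t) μ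
  mhat_meas : ∀ m, MeasurableSet[ℱ t₂] {ω | mhat ω = m}
  mhat_selected : ∀ ω,
    IsSelected Q (fun t : Fin t₂ => arm t ω) (fun t : Fin t₂ => reward t ω) (mhat ω)

/-! ### OFUL on a subspace -/

/-- The regularized Gram matrix `lam I + ∑ z_s z_sᵀ` of the projected arms `z_s = Π_m x_s`. -/
def gram {d : ℕ} (m : Submodule ℝ (Vec d)) (lam : ℝ) (I : Finset ℕ) (x : ℕ → Vec d) :
    Matrix (Fin d) (Fin d) ℝ :=
  lam • (1 : Matrix (Fin d) (Fin d) ℝ) +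
    ∑ s ∈ I, Matrix.vecMulVec (m.starProjection (x s)).ofLp (m.starProjection (x s)).ofLp

/-- The ridge estimator for the data `(z_s, y_s)`, `s ∈ I`. It lies in `m`. -/
def ridge {d : ℕ} (m : Submodule ℝ (Vec d)) (lam : ℝ) (I : Finset ℕ) (x : ℕ → Vec d)
    (y : ℕ → ℝ) : Vec d :=
  WithLp.toLp 2
    ((gram m lam I x)⁻¹.mulVec (∑ s ∈ I, y s • (m.starProjection (x s)).ofLp))

/-- The confidence radius
`σ √(2 log (det(V)^(1/2) det(lam I)^(-1/2) / δ)) + lam^(1/2) S`. Since `V` acts as `lam` on the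
orthogonal complement of `m`, the quotient of determinants is the one computed inside `m`. -/
def confRadius {d : ℕ} (m : Submodule ℝ (Vec d)) (σ lam S δ : ℝ) (I : Finset ℕ)
    (x : ℕ → Vec d) : ℝ :=
  σ * Real.sqrt (2 * Real.log (Real.sqrt ((gram m lam I x).det / lam ^ d) / δ)) +
    Real.sqrt lam * S

/-- The confidence ellipsoid of OFUL inside `m`. -/
def confSet {d : ℕ} (m : Submodule ℝ (Vec d)) (σ lam S δ : ℝ) (I : Finset ℕ)
    (x : ℕ → Vec d) (y : ℕ → ℝ) : Set (Vec d) :=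
  {θ | θ ∈ m ∧
    Real.sqrt ((θ - ridge m lam I x y).ofLp ⬝ᵥ
      ((gram m lam I x).mulVec (θ - ridge m lam I x y).ofLp)) ≤ confRadius m σ lam S δ I x}

/-- In the rounds `t₂, …, T - 1` the agent plays OFUL on the subspace `mhat`, started afresh in
round `t₂`: the arm is part of a maximizer `(x, θ)` of `⟨x, θ⟩` over `X` times the current
confidence ellipsoid. -/
def PlaysOFUL {d : ℕ} {Ω : Type*} (X : Set (Vec d)) (σ lam S δ : ℝ) (t₂ T : ℕ)
    (arm : ℕ → Ω → Vec d) (reward : ℕ → Ω → ℝ) (mhat : Ω → Submodule ℝ (Vec d)) : Prop :=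
  ∀ t, t₂ ≤ t → t < T → ∀ ω,
    ∃ θ' ∈ confSet (mhat ω) σ lam S δ (Finset.Ico t₂ t) (fun s => arm s ω) (fun s => reward s ω),
      ∀ x ∈ X,
        ∀ θ'' ∈ confSet (mhat ω) σ lam S δ (Finset.Ico t₂ t) (fun s => arm s ω)
          (fun s => reward s ω),
          inner ℝ x θ'' ≤ inner ℝ (arm t ω) θ'

/-- The expected cumulative regret `E[∑_t ⟨x⋆ - x_t, θ⟩]`. -/
def regret {d : ℕ} {Ω : Type*} [MeasurableSpace Ω] (μ : Measure Ω) (θ xstar : Vec d) (T : ℕ)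
    (arm : ℕ → Ω → Vec d) : ℝ :=
  ∫ ω, ∑ t ∈ Finset.range T, inner ℝ (xstar - arm t ω) θ ∂μ

/-- The exploration rate `σ² K² d₀ log(d T) / (C² ε²)`. -/
def exploreRate (σ K Cmin ε : ℝ) (d d₀ T : ℕ) : ℝ :=
  σ ^ 2 * K ^ 2 * (d₀ : ℝ) * Real.log ((d : ℝ) * (T : ℝ)) / (Cmin ^ 2 * ε ^ 2)

end SymBandit

end

/-! Two facts carry the proof: exploration finds a model containing θ, and OFUL on such a model
works in dimension at most d₀ instead of d.

Selection. Suppose that the selected m misses θ. Let v ∈ m be a least-squares fit and u = v - θ, a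
vector of M = m + Fix_G, which has dimension at most 2d₀. As m fits at least as well as Fix_G, S =
∑⟨x_t,u⟩² ≤ 2∑ η_t⟨x_t,u⟩ (`exists_sum_inner_sq_le_of_residual_le`). A self-normalized noise bound
turns this into an upper bound on S of order σ² d₀ log(dT). On the other hand S ≥ (t₂C/32)‖u‖², by a
Chernoff bound and a net (`measure_exists_sum_inner_sq_lt_le`), and ‖u‖² ≥ ε²/2, because v is
constant on an orbit where θ takes two values ε apart (`sq_le_norm_sub_sq_of_notMem`). For t₂ ≥ c₁E
this is a contradiction (`mem_of_isSelected`), and a union bound over exp(O(d₀ log(dT))) models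
gives `measure_notMem_le`.

Noise. By the method of mixtures, `mixture` is the likelihood ratio between a linear drift with
Gaussian prior and no drift: a nonnegative martingale of mean one, to which Ville's inequality
applies (`IsInteraction.measure_mixture_ge_le`). It is used on every M during exploration, and again
on the selected model from round t₂ on. There `{mhat = m}` is already decided, so no union bound is
paid.

Regret. Outside an event of probability 2/T, a round of OFUL costs at most 2R and at most 2β√w, with
w the squared V⁻¹-norm of the projected arm, and the sum of log(1 + w) is a log-determinant. Since λ
may be as small as order σ²C/R², this potential may contain log(R/σ), which the claimed bound does
not. The rounds are therefore split at w = τ with τ = max(1, R/(σT²)): the count of rounds with w ≥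
τ is divided by log(1 + τ), which absorbs log τ, and the factor √τ of the other rounds differs from
1 only when σT²τ = R, where it is charged to the R term (`scaled_term_le`). -/

noncomputable section

namespace SymBandit

open Matrix
open scoped ENNReal NNReal

/-! ### Quadratic forms, rank-one updates and determinants. -/

section QuadraticForms
variable {ι : Type*} [Fintype ι]

theorem dotProduct_mulVec_comm {M : Matrix ι ι ℝ} (hM : M.IsHermitian) (x y : ι → ℝ) :
    x ⬝ᵥ (M *ᵥ y) = y ⬝ᵥ (M *ᵥ x) := by
  have h : Mᵀ = M := by simpa [Matrix.IsHermitian, conjTranspose_eq_transpose_of_trivial] using hM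
  rw [dotProduct_mulVec, ← mulVec_transpose, h, dotProduct_comm]

theorem quadForm_nonneg {M : Matrix ι ι ℝ} (hM : M.PosSemidef) (x : ι → ℝ) :
    0 ≤ x ⬝ᵥ (M *ᵥ x) := by
  simpa using hM.dotProduct_mulVec_nonneg x

theorem quadForm_add {M : Matrix ι ι ℝ} (hM : M.IsHermitian) (x y : ι → ℝ) :
    (x + y) ⬝ᵥ (M *ᵥ (x + y)) = x ⬝ᵥ (M *ᵥ x) + 2 * (x ⬝ᵥ (M *ᵥ y)) + y ⬝ᵥ (M *ᵥ y) := by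
  rw [mulVec_add, dotProduct_add, add_dotProduct, add_dotProduct, dotProduct_mulVec_comm hM y x]
  ring

/-- The Cauchy-Schwarz inequality for a positive semidefinite matrix. -/
theorem sq_dotProduct_mulVec_le {M : Matrix ι ι ℝ} (hM : M.PosSemidef) (x y : ι → ℝ) :
    (x ⬝ᵥ (M *ᵥ y)) ^ 2 ≤ (x ⬝ᵥ (M *ᵥ x)) * (y ⬝ᵥ (M *ᵥ y)) := by
  have h : ∀ a : ℝ, 0 ≤ (y ⬝ᵥ (M *ᵥ y)) * (a * a) + (2 * (x ⬝ᵥ (M *ᵥ y))) * a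
      + x ⬝ᵥ (M *ᵥ x) := by
    intro a
    have h1 := quadForm_nonneg hM (x + a • y)
    rw [quadForm_add hM.1] at h1
    simp only [mulVec_smul, dotProduct_smul, smul_dotProduct, smul_eq_mul] at h1
    linarith
  have h2 := discrim_le_zero h
  rw [discrim] at h2
  linarith

theorem sqrt_quadForm_add_le {M : Matrix ι ι ℝ} (hM : M.PosSemidef) (x y : ι → ℝ) :
    √((x + y) ⬝ᵥ (M *ᵥ (x + y))) ≤ √(x ⬝ᵥ (M *ᵥ x)) + √(y ⬝ᵥ (M *ᵥ y)) := by
  apply Real.sqrt_le_iff.2 ⟨by positivity, ?_⟩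
  have h1 : x ⬝ᵥ (M *ᵥ y) ≤ √(x ⬝ᵥ (M *ᵥ x)) * √(y ⬝ᵥ (M *ᵥ y)) := by
    rw [← Real.sqrt_mul (quadForm_nonneg hM x)]
    exact Real.le_sqrt_of_sq_le (sq_dotProduct_mulVec_le hM x y)
  rw [quadForm_add hM.1, add_sq, Real.sq_sqrt (quadForm_nonneg hM x),
    Real.sq_sqrt (quadForm_nonneg hM y)]
  linarith

theorem posSemidef_vecMulVec_self (z : ι → ℝ) : (vecMulVec z z).PosSemidef := by
  simpa using posSemidef_vecMulVec_self_star z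

theorem vecMulVec_mulVec_eq (z x : ι → ℝ) : vecMulVec z z *ᵥ x = (z ⬝ᵥ x) • z := by
  ext i
  simp [mulVec, dotProduct, vecMulVec_apply, Finset.mul_sum, mul_comm, mul_left_comm]

variable [DecidableEq ι]

theorem mulVec_inv_mulVec {V : Matrix ι ι ℝ} (hV : V.PosDef) (x : ι → ℝ) :
    V *ᵥ (V⁻¹ *ᵥ x) = x := by
  rw [mulVec_mulVec, mul_nonsing_inv _ ((isUnit_iff_isUnit_det _).1 hV.isUnit), one_mulVec]

theorem inv_mulVec_mulVec {V : Matrix ι ι ℝ} (hV : V.PosDef) (x : ι → ℝ) :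
    V⁻¹ *ᵥ (V *ᵥ x) = x := by
  rw [mulVec_mulVec, nonsing_inv_mul _ ((isUnit_iff_isUnit_det _).1 hV.isUnit), one_mulVec]

/-- The Cauchy-Schwarz inequality between the norms of `V⁻¹` and `V`. -/
theorem dotProduct_le_sqrt_mul_sqrt {V : Matrix ι ι ℝ} (hV : V.PosDef) (x y : ι → ℝ) :
    x ⬝ᵥ y ≤ √(x ⬝ᵥ (V⁻¹ *ᵥ x)) * √(y ⬝ᵥ (V *ᵥ y)) := by
  rw [← Real.sqrt_mul (quadForm_nonneg hV.inv.posSemidef x)]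
  apply Real.le_sqrt_of_sq_le
  have h := sq_dotProduct_mulVec_le hV.inv.posSemidef x (V *ᵥ y)
  rwa [inv_mulVec_mulVec hV, dotProduct_comm (V *ᵥ y)] at h

/-- With p = V⁻¹x the hypothesis at p reads λ‖p‖² ≤ x·p; Cauchy-Schwarz for x·p and cancelling one
factor x·p finish. -/
theorem quadForm_inv_le {V : Matrix ι ι ℝ} (hV : V.PosDef) {lam : ℝ} (hlam : 0 < lam)
    (h : ∀ x, lam * (x ⬝ᵥ x) ≤ x ⬝ᵥ (V *ᵥ x)) (x : ι → ℝ) :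
    x ⬝ᵥ (V⁻¹ *ᵥ x) ≤ (x ⬝ᵥ x) / lam := by
  set p := V⁻¹ *ᵥ x with hp
  have h1 := h p
  rw [hp, mulVec_inv_mulVec hV, ← hp, dotProduct_comm p x] at h1
  have h2 : (x ⬝ᵥ p) ^ 2 ≤ (x ⬝ᵥ x) * (p ⬝ᵥ p) := by
    simpa using sq_dotProduct_mulVec_le (PosSemidef.one (n := ι) (R := ℝ)) x p
  have h3 : 0 ≤ x ⬝ᵥ x := by simpa using quadForm_nonneg (PosSemidef.one (n := ι) (R := ℝ)) x
  have h4 : 0 ≤ x ⬝ᵥ p := quadForm_nonneg hV.inv.posSemidef x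
  rw [le_div_iff₀ hlam]
  rcases h4.eq_or_lt with h5 | h5
  · rw [← h5]; simpa using h3
  · have h6 : lam * (x ⬝ᵥ p) ^ 2 ≤ (x ⬝ᵥ x) * (x ⬝ᵥ p) := by
      calc lam * (x ⬝ᵥ p) ^ 2 ≤ lam * ((x ⬝ᵥ x) * (p ⬝ᵥ p)) := by gcongr
        _ = (x ⬝ᵥ x) * (lam * (p ⬝ᵥ p)) := by ring
        _ ≤ _ := by gcongr
    nlinarith

theorem det_add_vecMulVec {V : Matrix ι ι ℝ} (hV : V.PosDef) (z : ι → ℝ) :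
    (V + vecMulVec z z).det = V.det * (1 + z ⬝ᵥ (V⁻¹ *ᵥ z)) := by
  have h := det_add_replicateCol_mul_replicateRow (ι := Unit)
    ((isUnit_iff_isUnit_det _).1 hV.isUnit) z z
  have h1 : replicateCol Unit z * replicateRow Unit z = vecMulVec z z :=
    (vecMulVec_eq Unit z z).symm
  rw [h1] at h
  rw [h, det_unique (n := Unit), Matrix.add_apply, one_apply_eq, Matrix.mul_assoc,
    ← replicateCol_mulVec, replicateRow_mul_replicateCol_apply]

/-- Sherman-Morrison in solved form: with p = V⁻¹s and q = V⁻¹z, the vector p + a q solves the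
updated system for the scalar a of the proof. It gives the one-step change of the exponent of
`mixture`. -/
theorem quadForm_inv_add_vecMulVec {V : Matrix ι ι ℝ} (hV : V.PosDef) (z s : ι → ℝ) (η : ℝ) :
    (s + η • z) ⬝ᵥ ((V + vecMulVec z z)⁻¹ *ᵥ (s + η • z)) =
      s ⬝ᵥ (V⁻¹ *ᵥ s) + η * (z ⬝ᵥ (V⁻¹ *ᵥ s)) +
        (η - z ⬝ᵥ (V⁻¹ *ᵥ s)) / (1 + z ⬝ᵥ (V⁻¹ *ᵥ z)) *
          (z ⬝ᵥ (V⁻¹ *ᵥ s) + η * (z ⬝ᵥ (V⁻¹ *ᵥ z))) := by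
  have hV' : (V + vecMulVec z z).PosDef := hV.add_posSemidef (posSemidef_vecMulVec_self z)
  have hw : 0 ≤ z ⬝ᵥ (V⁻¹ *ᵥ z) := quadForm_nonneg hV.inv.posSemidef z
  set p := V⁻¹ *ᵥ s with hp
  set q := V⁻¹ *ᵥ z with hq
  set a := (η - z ⬝ᵥ p) / (1 + z ⬝ᵥ q) with ha
  have h1 : (V + vecMulVec z z) *ᵥ (p + a • q) = s + η • z := by
    rw [add_mulVec, mulVec_add, mulVec_smul, vecMulVec_mulVec_eq, hp, hq, mulVec_inv_mulVec hV,
      mulVec_inv_mulVec hV, ← hp, ← hq, add_assoc, ← add_smul, dotProduct_add, dotProduct_smul,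
      smul_eq_mul]
    congr 2
    rw [ha]; field_simp; ring
  have h2 : s ⬝ᵥ q = z ⬝ᵥ p := dotProduct_mulVec_comm hV.inv.1 s z
  rw [← h1, inv_mulVec_mulVec hV', h1, add_dotProduct, dotProduct_add, dotProduct_add,
    dotProduct_smul, dotProduct_smul, smul_dotProduct, smul_dotProduct, h2]
  simp only [smul_eq_mul]
  ring

theorem det_one_add_eq_prod {M : Matrix ι ι ℝ} (hM : M.IsHermitian) :
    (1 + M).det = ∏ i, (1 + hM.eigenvalues i) := by
  have h := congrArg (Polynomial.eval (-1)) hM.charpoly_eq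
  rw [eval_charpoly, Polynomial.eval_prod] at h
  simp only [Polynomial.eval_sub, Polynomial.eval_X, Polynomial.eval_C] at h
  have h1 : (scalar ι (-1 : ℝ) - M) = -(1 + M) := by
    rw [map_neg, map_one]; abel
  have h2 : ∀ i, (-1 : ℝ) - ((hM.eigenvalues i : ℝ)) = -1 * (1 + hM.eigenvalues i) := by
    intro i; ring
  rw [h1, det_neg] at h
  simp only [RCLike.ofReal_real_eq_id, id, h2, Finset.prod_mul_distrib, Finset.prod_const,
    Finset.card_univ] at h
  exact mul_left_cancel₀ (pow_ne_zero _ (by norm_num)) h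

/-- Only nonzero eigenvalues give factors other than 1, and each eigenvalue is at most the trace.
The exponent is a rank and not the matrix size: this is where the dimension of the model replaces d.
-/
theorem det_one_add_le {M : Matrix ι ι ℝ} (hM : M.PosSemidef) {k : ℕ} (hk : M.rank ≤ k) {s : ℝ}
    (hs : M.trace ≤ s) : (1 + M).det ≤ (1 + s) ^ k := by
  have h0 := hM.eigenvalues_nonneg
  have htr : M.trace = ∑ i, hM.1.eigenvalues i := by simpa using hM.1.trace_eq_sum_eigenvalues
  have hle : ∀ i, hM.1.eigenvalues i ≤ s := fun i =>
    (Finset.single_le_sum (fun j _ => h0 j) (Finset.mem_univ i)).trans (htr ▸ hs)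
  have hs0 : 0 ≤ s := (htr ▸ Finset.sum_nonneg fun i _ => h0 i : 0 ≤ M.trace).trans hs
  rw [det_one_add_eq_prod hM.1, ← Finset.prod_filter_mul_prod_filter_not Finset.univ
    (fun i => hM.1.eigenvalues i ≠ 0)]
  have h1 : ∏ i with ¬ hM.1.eigenvalues i ≠ 0, (1 + hM.1.eigenvalues i) = 1 := by
    apply Finset.prod_eq_one
    intro i hi
    simp only [ne_eq, not_not, Finset.mem_filter] at hi
    rw [hi.2, add_zero]
  rw [h1, mul_one]
  calc ∏ i with hM.1.eigenvalues i ≠ 0, (1 + hM.1.eigenvalues i)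
      ≤ ∏ i with hM.1.eigenvalues i ≠ 0, (1 + s) :=
        Finset.prod_le_prod (fun i _ => by linarith [h0 i]) fun i _ => by linarith [hle i]
    _ = (1 + s) ^ M.rank := by
        rw [Finset.prod_const, hM.1.rank_eq_card_non_zero_eigs, Fintype.card_subtype]
    _ ≤ _ := pow_le_pow_right₀ (by linarith) hk

end QuadraticForms

/-! ### The regularized Gram matrix on a subspace. -/

section Gram
variable {d : ℕ} (m : Submodule ℝ (Vec d)) {lam : ℝ} (I : Finset ℕ) (x : ℕ → Vec d)

theorem dotProduct_eq_inner (u v : Vec d) : u.ofLp ⬝ᵥ v.ofLp = inner ℝ u v := by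
  simp [PiLp.inner_apply, dotProduct, mul_comm]

theorem dotProduct_self_eq (u : Vec d) : u.ofLp ⬝ᵥ u.ofLp = ‖u‖ ^ 2 := by
  rw [dotProduct_eq_inner, real_inner_self_eq_norm_sq]

theorem inner_starProjection_of_mem {m : Submodule ℝ (Vec d)} {v : Vec d} (hv : v ∈ m)
    (x : Vec d) : inner ℝ (m.starProjection x) v = inner ℝ x v := by
  rw [Submodule.inner_starProjection_left_eq_right,
    Submodule.starProjection_eq_self_iff.2 hv]

theorem gram_posDef (hlam : 0 < lam) : (gram m lam I x).PosDef :=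
  (PosDef.one.smul hlam).add_posSemidef
    (posSemidef_sum _ fun _ _ => posSemidef_vecMulVec_self _)

theorem gram_det_pos (hlam : 0 < lam) : 0 < (gram m lam I x).det := (gram_posDef m I x hlam).det_pos

@[simp] theorem gram_empty : gram m lam ∅ x = lam • 1 := by simp [gram]

theorem gram_Ico_succ {a t : ℕ} (h : a ≤ t) : gram m lam (Finset.Ico a (t + 1)) x =
    gram m lam (Finset.Ico a t) x +
      vecMulVec (m.starProjection (x t)).ofLp (m.starProjection (x t)).ofLp := by
  rw [gram, Finset.sum_Ico_succ_top h, ← add_assoc]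
  rfl

theorem gram_quadForm (v : Vec d) : v.ofLp ⬝ᵥ (gram m lam I x *ᵥ v.ofLp) =
    lam * ‖v‖ ^ 2 + ∑ s ∈ I, (inner ℝ (m.starProjection (x s)) v) ^ 2 := by
  rw [gram, add_mulVec, dotProduct_add, smul_mulVec, one_mulVec, dotProduct_smul,
    dotProduct_self_eq, sum_mulVec, dotProduct_sum, smul_eq_mul]
  congr 1
  refine Finset.sum_congr rfl fun s _ => ?_
  rw [vecMulVec_mulVec_eq, dotProduct_smul, dotProduct_eq_inner, dotProduct_eq_inner, smul_eq_mul,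
    real_inner_comm v]
  ring

theorem gram_quadForm_ge (v : Fin d → ℝ) :
    lam * (v ⬝ᵥ v) ≤ v ⬝ᵥ (gram m lam I x *ᵥ v) := by
  have h := gram_quadForm (lam := lam) m I x (WithLp.toLp 2 v)
  have h1 := dotProduct_self_eq (WithLp.toLp 2 v)
  simp only at h h1
  rw [h, h1]
  have : 0 ≤ ∑ s ∈ I, (inner ℝ (m.starProjection (x s)) (WithLp.toLp 2 v)) ^ 2 := by positivity
  linarith

theorem rank_sum_vecMulVec_le :
    (∑ s ∈ I, vecMulVec (m.starProjection (x s)).ofLp (m.starProjection (x s)).ofLp).rank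
      ≤ Module.finrank ℝ m := by
  have h : LinearMap.range (∑ s ∈ I, vecMulVec (m.starProjection (x s)).ofLp
      (m.starProjection (x s)).ofLp).mulVecLin ≤
      m.map (WithLp.linearEquiv 2 ℝ (Fin d → ℝ)).toLinearMap := by
    rintro _ ⟨v, rfl⟩
    rw [mulVecLin_apply, sum_mulVec]
    refine Submodule.sum_mem _ fun s _ => ?_
    rw [vecMulVec_mulVec_eq]
    refine Submodule.smul_mem _ _ ⟨m.starProjection (x s), ?_, rfl⟩
    exact Submodule.starProjection_apply_mem m (x s)
  rw [Matrix.rank]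
  exact (Submodule.finrank_mono h).trans (Submodule.finrank_map_le _ _)

/-- The ratio of determinants is at most `(1 + |I| K / lam) ^ k` on a subspace of dimension `k`. -/
theorem gram_det_div_le (hlam : 0 < lam) {k n : ℕ} (hk : Module.finrank ℝ m ≤ k) {K : ℝ}
    (hK0 : 0 ≤ K) (hI : I.card ≤ n)
    (hK : ∀ s ∈ I, ‖m.starProjection (x s)‖ ^ 2 ≤ K) :
    (gram m lam I x).det / lam ^ d ≤ (1 + n * K / lam) ^ k := by
  set M := ∑ s ∈ I, vecMulVec (m.starProjection (x s)).ofLp (m.starProjection (x s)).ofLp with hM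
  have hpsd : M.PosSemidef := posSemidef_sum _ fun _ _ => posSemidef_vecMulVec_self _
  have h1 : gram m lam I x = lam • (1 + lam⁻¹ • M) := by
    rw [smul_add, smul_smul, mul_inv_cancel₀ hlam.ne', one_smul]
    rfl
  rw [h1, det_smul, Fintype.card_fin, mul_div_cancel_left₀ _ (by positivity)]
  apply det_one_add_le (hpsd.smul (inv_nonneg.2 hlam.le))
  · rw [rank_smul_of_mem_nonZeroDivisors _ (mem_nonZeroDivisors_of_ne_zero (inv_ne_zero hlam.ne'))]
    exact (rank_sum_vecMulVec_le m I x).trans hk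
  · rw [trace_smul, hM, trace_sum, smul_eq_mul, mul_comm, ← div_eq_mul_inv]
    gcongr
    calc ∑ s ∈ I, (vecMulVec (m.starProjection (x s)).ofLp (m.starProjection (x s)).ofLp).trace
        ≤ ∑ s ∈ I, K := Finset.sum_le_sum fun s hs => by
          rw [trace_vecMulVec, dotProduct_self_eq]; exact hK s hs
      _ ≤ n * K := by
          rw [Finset.sum_const, nsmul_eq_mul]; gcongr

end Gram

/-! ### Ville's maximal inequality. -/

section Ville
variable {Ω : Type*} {mΩ : MeasurableSpace Ω} {μ : Measure Ω} {ℱ : Filtration ℕ mΩ}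

/-- Ville's maximal inequality for a nonnegative martingale between the times `a` and `b`. -/
theorem mul_measure_exists_ge_le {N : ℕ → Ω → ℝ≥0∞} {a b : ℕ} (hab : a ≤ b)
    (hmeas : ∀ t, a ≤ t → t ≤ b → Measurable[ℱ t] (N t))
    (hstep : ∀ t, a ≤ t → t < b → ∀ A, MeasurableSet[ℱ t] A →
      ∫⁻ ω in A, N (t + 1) ω ∂μ = ∫⁻ ω in A, N t ω ∂μ)
    (c : ℝ≥0∞) {F : Set Ω} (hF : MeasurableSet[ℱ a] F) :
    c * μ (F ∩ {ω | ∃ t, a ≤ t ∧ t ≤ b ∧ c ≤ N t ω}) ≤ ∫⁻ ω in F, N a ω ∂μ := by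
  induction hab using Nat.decreasingInduction generalizing F with
  | self =>
    have hle : ℱ b ≤ mΩ := ℱ.le b
    have hN : Measurable (N b) := (hmeas b le_rfl le_rfl).mono hle le_rfl
    have hset : F ∩ {ω | ∃ t, b ≤ t ∧ t ≤ b ∧ c ≤ N t ω} ⊆ {ω | c ≤ N b ω} ∩ F := by
      rintro ω ⟨hω, t, h1, h2, h3⟩
      obtain rfl : t = b := le_antisymm h2 h1
      exact ⟨h3, hω⟩
    calc c * μ (F ∩ {ω | ∃ t, b ≤ t ∧ t ≤ b ∧ c ≤ N t ω})
        ≤ c * μ.restrict F {ω | c ≤ N b ω} := by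
          rw [Measure.restrict_apply (show MeasurableSet {ω | c ≤ N b ω} from hN measurableSet_Ici)]
          gcongr
      _ ≤ _ := mul_meas_ge_le_lintegral hN c
  | of_succ a hab ih =>
    have hle : ℱ a ≤ mΩ := ℱ.le a
    have hB : MeasurableSet[ℱ a] {ω | c ≤ N a ω} := hmeas a le_rfl hab.le measurableSet_Ici
    have hB' : MeasurableSet {ω | c ≤ N a ω} := hle _ hB
    have hN : Measurable (N a) := (hmeas a le_rfl hab.le).mono hle le_rfl
    -- Paths that have reached c at time a are set aside. The remaining set is known at time a, so
    -- the martingale identity brings the integral of `N (a + 1)` back to `N a`.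
    have h2 := ih (fun t h1 => hmeas t (by omega)) (fun t h1 => hstep t (by omega))
      (F := F \ {ω | c ≤ N a ω}) (ℱ.mono (Nat.le_succ a) _ (hF.diff hB))
    rw [hstep a le_rfl hab _ (hF.diff hB)] at h2
    have h1 : c * μ (F ∩ {ω | c ≤ N a ω}) ≤ ∫⁻ ω in F ∩ {ω | c ≤ N a ω}, N a ω ∂μ := by
      rw [← setLIntegral_const]
      refine setLIntegral_mono hN ?_
      exact fun ω hω => hω.2
    calc c * μ (F ∩ {ω | ∃ t, a ≤ t ∧ t ≤ b ∧ c ≤ N t ω})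
        ≤ c * μ ((F ∩ {ω | c ≤ N a ω}) ∪
          ((F \ {ω | c ≤ N a ω}) ∩ {ω | ∃ t, a + 1 ≤ t ∧ t ≤ b ∧ c ≤ N t ω})) := by
          gcongr
          rintro ω ⟨hω, t, h1, h2, h3⟩
          by_cases h : c ≤ N a ω
          · exact Or.inl ⟨hω, h⟩
          · refine Or.inr ⟨⟨hω, h⟩, t, ?_, h2, h3⟩
            rcases h1.eq_or_lt with rfl | h4
            · exact absurd h3 h
            · exact h4
      _ ≤ c * μ (F ∩ {ω | c ≤ N a ω}) +
          c * μ ((F \ {ω | c ≤ N a ω}) ∩ {ω | ∃ t, a + 1 ≤ t ∧ t ≤ b ∧ c ≤ N t ω}) := by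
          rw [← mul_add]; gcongr; exact measure_union_le _ _
      _ ≤ ∫⁻ ω in F ∩ {ω | c ≤ N a ω}, N a ω ∂μ +
          ∫⁻ ω in F \ {ω | c ≤ N a ω}, N a ω ∂μ := add_le_add h1 h2
      _ = _ := lintegral_inter_add_sdiff _ _ hB'

end Ville

/-! ### Gaussian likelihood ratios. -/

section LikelihoodRatio

/-- The density of `N(b, σ² (1 + w))` relative to `N(0, σ²)`. -/
def gaussianRatio (σ b w y : ℝ) : ℝ :=
  (√(1 + w))⁻¹ * Real.exp ((y ^ 2 * w + 2 * y * b - b ^ 2) / (2 * σ ^ 2 * (1 + w)))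

theorem measurable_gaussianRatio (σ : ℝ) :
    Measurable fun p : (ℝ × ℝ) × ℝ => gaussianRatio σ p.1.1 p.1.2 p.2 := by
  unfold gaussianRatio
  fun_prop

theorem lintegral_gaussianRatio {σ : ℝ} (hσ : 0 < σ) (b : ℝ) {w : ℝ} (hw : 0 ≤ w) :
    ∫⁻ y, ENNReal.ofReal (gaussianRatio σ b w y) ∂gaussianReal 0 (σ ^ 2).toNNReal = 1 := by
  have hσ2 : (0 : ℝ) < σ ^ 2 := by positivity
  have hv : (σ ^ 2).toNNReal ≠ 0 := by simp [hσ.ne']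
  have hv' : (σ ^ 2 * (1 + w)).toNNReal ≠ 0 := by
    simp only [ne_eq, Real.toNNReal_eq_zero, not_le]; positivity
  have hmeas : Measurable fun y => ENNReal.ofReal (gaussianRatio σ b w y) := by
    unfold gaussianRatio; fun_prop
  rw [gaussianReal_of_var_ne_zero _ hv,
    lintegral_withDensity_eq_lintegral_mul _ (measurable_gaussianPDF _ _) hmeas,
    ← lintegral_gaussianPDF_eq_one b hv']
  congr 1
  ext y
  rw [Pi.mul_apply, gaussianPDF, gaussianPDF, ← ENNReal.ofReal_mul (gaussianPDFReal_nonneg _ _ _)]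
  congr 1
  rw [gaussianPDFReal, gaussianPDFReal, gaussianRatio, Real.coe_toNNReal _ hσ2.le,
    Real.coe_toNNReal _ (by positivity), ← mul_assoc (2 * Real.pi),
    Real.sqrt_mul (by positivity) (1 + w),
    mul_inv, mul_mul_mul_comm, ← Real.exp_add]
  congr 2
  field_simp
  ring

/-- Freezing: the triple (g, b, w) is independent of η, so η can be integrated out first with b and
w held fixed, and a density integrates to 1. -/
theorem lintegral_mul_gaussianRatio {Ω : Type*} {𝒢 mΩ : MeasurableSpace Ω} {μ : Measure Ω}
    [IsProbabilityMeasure μ]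
    (h𝒢 : 𝒢 ≤ mΩ) {σ : ℝ} (hσ : 0 < σ) {η : Ω → ℝ} (hη : Measurable η)
    (hlaw : μ.map η = gaussianReal 0 (σ ^ 2).toNNReal)
    (hind : Indep (MeasurableSpace.comap η inferInstance) 𝒢 μ)
    {g : Ω → ℝ≥0∞} (hg : Measurable[𝒢] g) {b w : Ω → ℝ} (hb : Measurable[𝒢] b)
    (hw : Measurable[𝒢] w) (hw0 : ∀ ω, 0 ≤ w ω) :
    ∫⁻ ω, g ω * ENNReal.ofReal (gaussianRatio σ (b ω) (w ω) (η ω)) ∂μ = ∫⁻ ω, g ω ∂μ := by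
  set X : Ω → ℝ≥0∞ × (ℝ × ℝ) := fun ω => (g ω, (b ω, w ω)) with hX
  have hX𝒢 : Measurable[𝒢] X := Measurable.prodMk hg (Measurable.prodMk hb hw)
  have hXm : Measurable X := hX𝒢.mono h𝒢 le_rfl
  have hXη : IndepFun X η μ :=
    (indep_of_indep_of_le_right hind (measurable_iff_comap_le.1 hX𝒢)).symm
  have hmap := (indepFun_iff_map_prod_eq_prod_map_map hXm.aemeasurable hη.aemeasurable).1 hXη
  set Φ : (ℝ≥0∞ × (ℝ × ℝ)) × ℝ → ℝ≥0∞ := fun p =>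
    p.1.1 * ENNReal.ofReal (gaussianRatio σ p.1.2.1 p.1.2.2 p.2) with hΦ
  have hΦm : Measurable Φ := by
    refine Measurable.mul (by fun_prop) (ENNReal.measurable_ofReal.comp ?_)
    exact (measurable_gaussianRatio σ).comp
      (f := fun p : (ℝ≥0∞ × (ℝ × ℝ)) × ℝ => (p.1.2, p.2)) (by fun_prop)
  have : IsProbabilityMeasure (μ.map η) := Measure.isProbabilityMeasure_map hη.aemeasurable
  calc ∫⁻ ω, g ω * ENNReal.ofReal (gaussianRatio σ (b ω) (w ω) (η ω)) ∂μ
      = ∫⁻ p, Φ p ∂(μ.map fun ω => (X ω, η ω)) := (lintegral_map hΦm (hXm.prodMk hη)).symm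
    _ = ∫⁻ x, ∫⁻ y, Φ (x, y) ∂(μ.map η) ∂(μ.map X) := by
        rw [hmap, lintegral_prod _ hΦm.aemeasurable]
    _ = ∫⁻ ω, ∫⁻ y, Φ (X ω, y) ∂(μ.map η) ∂μ :=
        lintegral_map hΦm.lintegral_prod_right' hXm
    _ = ∫⁻ ω, g ω ∂μ := by
        refine lintegral_congr fun ω => ?_
        have hm : Measurable fun y => ENNReal.ofReal (gaussianRatio σ (b ω) (w ω) y) := by
          unfold gaussianRatio; fun_prop
        simp only [hΦ, hX]
        rw [lintegral_const_mul _ hm, hlaw, lintegral_gaussianRatio hσ _ (hw0 ω), mul_one]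

end LikelihoodRatio

/-! ### Measurability of matrix operations. -/

section Measurability
variable {Ω : Type*} {mΩ : MeasurableSpace Ω} {ι : Type*} [Fintype ι]

theorem measurable_dotProduct {u v : Ω → ι → ℝ} (hu : Measurable u) (hv : Measurable v) :
    Measurable fun ω => u ω ⬝ᵥ v ω := by
  unfold dotProduct
  exact Finset.measurable_fun_sum _ fun i _ =>
    ((measurable_pi_apply i).comp hu).mul ((measurable_pi_apply i).comp hv)

theorem measurable_mulVec {A : Ω → Matrix ι ι ℝ} {v : Ω → ι → ℝ}
    (hA : ∀ i j, Measurable fun ω => A ω i j) (hv : Measurable v) :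
    Measurable fun ω => A ω *ᵥ v ω := by
  refine measurable_pi_iff.2 fun i => ?_
  exact measurable_dotProduct (measurable_pi_iff.2 (hA i)) hv

variable [DecidableEq ι]

theorem measurable_det {A : Ω → Matrix ι ι ℝ} (hA : ∀ i j, Measurable fun ω => A ω i j) :
    Measurable fun ω => (A ω).det := by
  simp only [det_apply]
  exact Finset.measurable_fun_sum _ fun g _ =>
    (Finset.measurable_fun_prod _ fun i _ => hA _ _).const_smul _

theorem measurable_matrix_inv {A : Ω → Matrix ι ι ℝ} (hA : ∀ i j, Measurable fun ω => A ω i j)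
    (i j : ι) : Measurable fun ω => (A ω)⁻¹ i j := by
  simp only [inv_def, Ring.inverse_eq_inv, Matrix.smul_apply, smul_eq_mul, adjugate_apply]
  refine (measurable_det hA).inv.mul (measurable_det fun k l => ?_)
  by_cases h : k = j
  · subst h; simp only [updateRow_self]; exact measurable_const
  · simp only [updateRow_ne h]; exact hA k l

end Measurability

/-! ### The mixture martingale. -/

section Mixture
variable {d : ℕ} {Ω : Type*}

/-- The sum of the projected arms, weighted with the noise. -/
def noiseSum (m : Submodule ℝ (Vec d)) (θ : Vec d) (arm : ℕ → Ω → Vec d) (reward : ℕ → Ω → ℝ)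
    (a t : ℕ) (ω : Ω) : Fin d → ℝ :=
  ∑ s ∈ Finset.Ico a t, noise θ arm reward s ω • (m.starProjection (arm s ω)).ofLp

/-- The Gaussian mixture of the exponential martingales of the noise after time `a`. -/
def mixture (m : Submodule ℝ (Vec d)) (lam σ : ℝ) (θ : Vec d) (arm : ℕ → Ω → Vec d)
    (reward : ℕ → Ω → ℝ) (a t : ℕ) (ω : Ω) : ℝ :=
  (√((gram m lam (Finset.Ico a t) fun s => arm s ω).det / lam ^ d))⁻¹ *
    Real.exp ((noiseSum m θ arm reward a t ω ⬝ᵥ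
      ((gram m lam (Finset.Ico a t) fun s => arm s ω)⁻¹ *ᵥ noiseSum m θ arm reward a t ω)) /
        (2 * σ ^ 2))

variable (m : Submodule ℝ (Vec d)) {lam σ : ℝ} (θ : Vec d) (arm : ℕ → Ω → Vec d)
    (reward : ℕ → Ω → ℝ)

theorem mixture_self (hlam : 0 < lam) (a : ℕ) (ω : Ω) :
    mixture m lam σ θ arm reward a a ω = 1 := by
  have : lam ^ d ≠ 0 := by positivity
  simp [mixture, noiseSum, this]

theorem noiseSum_succ {a t : ℕ} (h : a ≤ t) (ω : Ω) :
    noiseSum m θ arm reward a (t + 1) ω = noiseSum m θ arm reward a t ω +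
      noise θ arm reward t ω • (m.starProjection (arm t ω)).ofLp := by
  rw [noiseSum, Finset.sum_Ico_succ_top h]
  rfl

/-- Under the prior N(0, σ²/λ · I) on the drift, with s the noise sum so far, the predictive law of
the next noise is N(z·V⁻¹s, σ²(1 + z·V⁻¹z)). The mixture is multiplied by its density relative to
N(0, σ²), whose parameters are known before the noise is seen. -/
theorem mixture_succ (hlam : 0 < lam) (hσ : 0 < σ) {a t : ℕ} (h : a ≤ t) (ω : Ω) :
    mixture m lam σ θ arm reward a (t + 1) ω = mixture m lam σ θ arm reward a t ω *
      gaussianRatio σ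
        ((m.starProjection (arm t ω)).ofLp ⬝ᵥ
          ((gram m lam (Finset.Ico a t) fun s => arm s ω)⁻¹ *ᵥ noiseSum m θ arm reward a t ω))
        ((m.starProjection (arm t ω)).ofLp ⬝ᵥ
          ((gram m lam (Finset.Ico a t) fun s => arm s ω)⁻¹ *ᵥ
            (m.starProjection (arm t ω)).ofLp))
        (noise θ arm reward t ω) := by
  have hV := gram_posDef m (Finset.Ico a t) (fun s => arm s ω) hlam
  have hdet := hV.det_pos
  rw [mixture, gram_Ico_succ m _ h, noiseSum_succ m θ arm reward h, quadForm_inv_add_vecMulVec hV,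
    det_add_vecMulVec hV, mixture, gaussianRatio]
  set V := gram m lam (Finset.Ico a t) fun s => arm s ω
  set z := (m.starProjection (arm t ω)).ofLp
  set S := noiseSum m θ arm reward a t ω
  have hw : 0 ≤ z ⬝ᵥ (V⁻¹ *ᵥ z) := quadForm_nonneg hV.inv.posSemidef z
  set w := z ⬝ᵥ (V⁻¹ *ᵥ z)
  have h1 : V.det * (1 + w) / lam ^ d = V.det / lam ^ d * (1 + w) := by ring
  rw [h1, Real.sqrt_mul (by positivity), mul_inv, mul_mul_mul_comm, ← Real.exp_add]
  congr 2
  field_simp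
  ring

variable {mΩ : MeasurableSpace Ω} {μ : Measure Ω} {ℱ : Filtration ℕ mΩ} {X : Set (Vec d)} {T : ℕ}
variable {θ arm reward}

theorem IsInteraction.measurable_arm (h : IsInteraction μ ℱ X θ σ T arm reward) {s t : ℕ}
    (hs : s < T) (hst : s ≤ t) : Measurable[ℱ t] (arm s) :=
  (h.arm_meas s hs).mono (ℱ.mono hst) le_rfl

theorem IsInteraction.measurable_noise (h : IsInteraction μ ℱ X θ σ T arm reward) {s t : ℕ}
    (hs : s < T) (hst : s < t) : Measurable[ℱ t] (noise θ arm reward s) := by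
  unfold noise
  have h1 : Measurable[ℱ t] (reward s) := (h.reward_meas s hs).mono (ℱ.mono hst) le_rfl
  have h2 : Measurable fun v : Vec d => inner ℝ v θ := by fun_prop
  exact h1.sub (h2.comp (h.measurable_arm hs hst.le))

theorem IsInteraction.measurable_proj (h : IsInteraction μ ℱ X θ σ T arm reward) {s t : ℕ}
    (hs : s < T) (hst : s ≤ t) :
    Measurable[ℱ t] fun ω => (m.starProjection (arm s ω)).ofLp := by
  have h2 : Measurable fun v : Vec d => (m.starProjection v).ofLp := by fun_prop
  exact h2.comp (h.measurable_arm hs hst)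

theorem IsInteraction.measurable_gram (h : IsInteraction μ ℱ X θ σ T arm reward) {a t : ℕ}
    (ht : t ≤ T) (i j : Fin d) :
    Measurable[ℱ t] fun ω => gram m lam (Finset.Ico a t) (fun s => arm s ω) i j := by
  simp only [gram, Matrix.add_apply, Matrix.sum_apply, vecMulVec_apply]
  refine Measurable.const_add (Finset.measurable_fun_sum _ fun s hs => ?_) _
  rw [Finset.mem_Ico] at hs
  have h1 := h.measurable_proj m (hs.2.trans_le ht) hs.2.le
  exact ((measurable_pi_apply i).comp h1).mul ((measurable_pi_apply j).comp h1)

theorem IsInteraction.measurable_noiseSum (h : IsInteraction μ ℱ X θ σ T arm reward) {a t : ℕ}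
    (ht : t ≤ T) : Measurable[ℱ t] (noiseSum m θ arm reward a t) := by
  unfold noiseSum
  refine Finset.measurable_fun_sum _ fun s hs => ?_
  rw [Finset.mem_Ico] at hs
  exact (h.measurable_noise (hs.2.trans_le ht) hs.2).smul
    (h.measurable_proj m (hs.2.trans_le ht) hs.2.le)

theorem IsInteraction.measurable_mixture (h : IsInteraction μ ℱ X θ σ T arm reward) {a t : ℕ}
    (ht : t ≤ T) : Measurable[ℱ t] (mixture m lam σ θ arm reward a t) := by
  unfold mixture
  have h1 := h.measurable_gram m (lam := lam) (a := a) ht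
  have h2 := h.measurable_noiseSum m (a := a) ht
  refine Measurable.mul ?_ ?_
  · exact (Real.continuous_sqrt.measurable.comp ((measurable_det h1).div_const _)).inv
  · exact Real.measurable_exp.comp ((measurable_dotProduct h2
      (measurable_mulVec (measurable_matrix_inv h1) h2)).div_const _)

theorem mixture_nonneg (a t : ℕ) (ω : Ω) : 0 ≤ mixture m lam σ θ arm reward a t ω := by
  unfold mixture; positivity

theorem IsInteraction.setLIntegral_mixture_succ [IsProbabilityMeasure μ]
    (h : IsInteraction μ ℱ X θ σ T arm reward) (hlam : 0 < lam) (hσ : 0 < σ) {a t : ℕ}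
    (hat : a ≤ t) (ht : t < T) {A : Set Ω} (hA : MeasurableSet[ℱ t] A) :
    ∫⁻ ω in A, ENNReal.ofReal (mixture m lam σ θ arm reward a (t + 1) ω) ∂μ =
      ∫⁻ ω in A, ENNReal.ofReal (mixture m lam σ θ arm reward a t ω) ∂μ := by
  have hA' : MeasurableSet A := ℱ.le t A hA
  have hM := h.measurable_mixture m (lam := lam) (a := a) ht.le
  have hg : Measurable[ℱ t]
      (A.indicator fun ω => ENNReal.ofReal (mixture m lam σ θ arm reward a t ω)) :=
    Measurable.indicator (ENNReal.measurable_ofReal.comp hM) hA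
  have hG := measurable_matrix_inv (h.measurable_gram m (lam := lam) (a := a) ht.le)
  have hz := h.measurable_proj m ht le_rfl
  have hS := h.measurable_noiseSum m (a := a) ht.le
  have hη : Measurable (noise θ arm reward t) :=
    (h.measurable_noise ht (Nat.lt_succ_self t)).mono (ℱ.le _) le_rfl
  have key := lintegral_mul_gaussianRatio (ℱ.le t) hσ hη (h.noise_law t ht) (h.noise_indep t ht) hg
    (measurable_dotProduct hz (measurable_mulVec hG hS))
    (measurable_dotProduct hz (measurable_mulVec hG hz))
    (fun ω => quadForm_nonneg
      (gram_posDef m (Finset.Ico a t) (fun s => arm s ω) hlam).inv.posSemidef _)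
  rw [← lintegral_indicator hA', ← lintegral_indicator hA', ← key]
  refine lintegral_congr fun ω => ?_
  by_cases hω : ω ∈ A
  · rw [Set.indicator_of_mem hω, Set.indicator_of_mem hω, mixture_succ m θ arm reward hlam hσ hat,
      ENNReal.ofReal_mul (mixture_nonneg m a t ω)]
  · rw [Set.indicator_of_notMem hω, Set.indicator_of_notMem hω, zero_mul]

/-- The self-normalized maximal inequality: after time `a`, the mixture exceeds the level `c`
with probability at most `1 / c`. -/
theorem IsInteraction.measure_mixture_ge_le [IsProbabilityMeasure μ]
    (h : IsInteraction μ ℱ X θ σ T arm reward) (hlam : 0 < lam) (hσ : 0 < σ) {a b : ℕ}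
    (hab : a ≤ b) (hb : b ≤ T) {c : ℝ} (hc : 0 < c) {F : Set Ω} (hF : MeasurableSet[ℱ a] F) :
    μ (F ∩ {ω | ∃ t, a ≤ t ∧ t ≤ b ∧ c ≤ mixture m lam σ θ arm reward a t ω}) ≤
      ENNReal.ofReal c⁻¹ * μ F := by
  have key := mul_measure_exists_ge_le (μ := μ)
    (N := fun t ω => ENNReal.ofReal (mixture m lam σ θ arm reward a t ω)) hab
    (fun t _ h2 => ENNReal.measurable_ofReal.comp (h.measurable_mixture m (h2.trans hb)))
    (fun t h1 h2 A hA => h.setLIntegral_mixture_succ m hlam hσ h1 (h2.trans_le hb) hA)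
    (ENNReal.ofReal c) hF
  simp only [mixture_self m θ arm reward hlam, ENNReal.ofReal_one, setLIntegral_one] at key
  rw [ENNReal.ofReal_inv_of_pos hc, ← ENNReal.div_eq_inv_mul, ENNReal.le_div_iff_mul_le
    (Or.inl (by simpa using hc)) (Or.inl ENNReal.ofReal_ne_top), mul_comm]
  refine le_trans (mul_le_mul_right (measure_mono ?_) _) key
  rintro ω ⟨hω, t, h1, h2, h3⟩
  exact ⟨hω, t, h1, h2, ENNReal.ofReal_le_ofReal h3⟩

end Mixture

/-! ### The second moment of the exploratory distribution. -/

section SecondMoment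
variable {d : ℕ} {ν : Measure (Vec d)}

/-- Positivity excludes the default value: an infimum that is not bounded below would be 0. -/
theorem lamMin_le_of_norm_eq_one {B : Matrix (Fin d) (Fin d) ℝ} (hB : 0 < lamMin B) {v : Vec d}
    (hv : ‖v‖ = 1) : lamMin B ≤ v.ofLp ⬝ᵥ (B *ᵥ v.ofLp) := by
  have hbdd : BddBelow (Set.range fun v : Metric.sphere (0 : Vec d) 1 =>
      (v : Vec d).ofLp ⬝ᵥ (B *ᵥ (v : Vec d).ofLp)) := by
    by_contra h
    rw [lamMin, Real.iInf_of_not_bddBelow h] at hB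
    exact lt_irrefl _ hB
  exact ciInf_le hbdd ⟨v, by simpa using hv⟩

/-- Second moments exist because of positivity alone: if x_i² were not integrable, its integral
would be 0 by default, and the i-th unit vector would have Rayleigh quotient 0. -/
theorem integrable_mul_of_lamMin_pos (hν : 0 < lamMin (secondMoment ν)) (i j : Fin d) :
    Integrable (fun x : Vec d => x i * x j) ν := by
  have hsq : ∀ i : Fin d, Integrable (fun x : Vec d => x i * x i) ν := by
    intro i
    by_contra h
    have h1 := lamMin_le_of_norm_eq_one hν (v := EuclideanSpace.single i (1 : ℝ)) (by simp)
    have h2 : (secondMoment ν) i i = 0 := integral_undef h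
    simp [h2] at h1
    linarith
  refine ((hsq i).add (hsq j)).mono' (by fun_prop) (ae_of_all _ fun x => ?_)
  simp only [Real.norm_eq_abs, abs_mul, Pi.add_apply]
  nlinarith [sq_nonneg (|x i| - |x j|), abs_mul_abs_self (x i), abs_mul_abs_self (x j),
    mul_self_nonneg (x i), mul_self_nonneg (x j)]

theorem inner_sq_eq_sum (x v : Vec d) :
    (inner ℝ x v) ^ 2 = ∑ i, ∑ j, v i * v j * (x i * x j) := by
  rw [← dotProduct_eq_inner, sq, dotProduct, Finset.sum_mul_sum]
  refine Finset.sum_congr rfl fun i _ => Finset.sum_congr rfl fun j _ => ?_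
  ring

theorem integrable_inner_sq (hν : 0 < lamMin (secondMoment ν)) (v : Vec d) :
    Integrable (fun x => (inner ℝ x v) ^ 2) ν := by
  simp only [inner_sq_eq_sum]
  exact integrable_finsetSum _ fun i _ => integrable_finsetSum _ fun j _ =>
    (integrable_mul_of_lamMin_pos hν i j).const_mul _

theorem integral_inner_sq (hν : 0 < lamMin (secondMoment ν)) (v : Vec d) :
    ∫ x, (inner ℝ x v) ^ 2 ∂ν = v.ofLp ⬝ᵥ (secondMoment ν *ᵥ v.ofLp) := by
  have hint := integrable_mul_of_lamMin_pos hν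
  simp only [inner_sq_eq_sum]
  rw [integral_finsetSum _ fun i _ => integrable_finsetSum _ fun j _ => (hint i j).const_mul _]
  simp only [dotProduct, mulVec, Finset.mul_sum]
  refine Finset.sum_congr rfl fun i _ => ?_
  rw [integral_finsetSum _ fun j _ => (hint i j).const_mul _]
  refine Finset.sum_congr rfl fun j _ => ?_
  rw [integral_const_mul, secondMoment]
  ring

theorem lamMin_mul_le_integral (hν : 0 < lamMin (secondMoment ν)) (v : Vec d) :
    lamMin (secondMoment ν) * ‖v‖ ^ 2 ≤ ∫ x, (inner ℝ x v) ^ 2 ∂ν := by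
  rcases eq_or_ne v 0 with rfl | hv
  · simp
  have hv' : ‖v‖ ≠ 0 := norm_ne_zero_iff.2 hv
  have h1 := lamMin_le_of_norm_eq_one hν (v := ‖v‖⁻¹ • v) (by simp [norm_smul, hv'])
  rw [← integral_inner_sq hν] at h1
  simp only [inner_smul_right, mul_pow, integral_const_mul] at h1
  calc lamMin (secondMoment ν) * ‖v‖ ^ 2
      ≤ (‖v‖⁻¹ ^ 2 * ∫ x, (inner ℝ x v) ^ 2 ∂ν) * ‖v‖ ^ 2 := by gcongr
    _ = _ := by field_simp

end SecondMoment

/-! ### A lower tail bound for the design in one direction. -/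

section Chernoff
variable {d : ℕ} {Ω : Type*} {mΩ : MeasurableSpace Ω} {μ : Measure Ω} {ℱ : Filtration ℕ mΩ}
  {X : Set (Vec d)} {θ : Vec d} {σ : ℝ} {T t₂ : ℕ} {arm : ℕ → Ω → Vec d} {reward : ℕ → Ω → ℝ}
  {Q : Set (Setoid (Fin d))} {ν : Measure (Vec d)} {mhat : Ω → Submodule ℝ (Vec d)}

theorem measurable_history_arm {s t : ℕ} (h : s < t) :
    Measurable[history arm reward t] (arm s) :=
  measurable_iff_comap_le.2 (le_sup_left.trans
    (le_iSup (fun s : Fin t => MeasurableSpace.comap (arm s) inferInstance ⊔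
      MeasurableSpace.comap (reward s) inferInstance) ⟨s, h⟩))

theorem IsInteraction.history_le (h : IsInteraction μ ℱ X θ σ T arm reward) {t : ℕ} (ht : t ≤ T) :
    history arm reward t ≤ mΩ := by
  refine iSup_le fun s => sup_le ?_ ?_
  · exact ((h.arm_meas s (s.2.trans_le ht)).mono (ℱ.le _) le_rfl).comap_le
  · exact ((h.reward_meas s (s.2.trans_le ht)).mono (ℱ.le _) le_rfl).comap_le

/-- Independence of each arm from the earlier observations is enough to split off the last factor,
since the earlier arms belong to that history. -/
theorem lintegral_prod_arm [IsProbabilityMeasure μ] (h : IsInteraction μ ℱ X θ σ T arm reward)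
    (hE : ExploresAndSelects μ ℱ Q ν t₂ arm reward mhat) (ht₂ : t₂ ≤ T)
    {f : Vec d → ℝ≥0∞} (hf : Measurable f) {n : ℕ} (hn : n ≤ t₂) :
    ∫⁻ ω, ∏ t ∈ Finset.range n, f (arm t ω) ∂μ = (∫⁻ x, f x ∂ν) ^ n := by
  induction n with
  | zero => simp
  | succ n ih =>
    have hn' : n < t₂ := hn
    have harm : Measurable (arm n) := (h.arm_meas n (by omega)).mono (ℱ.le _) le_rfl
    have key := lintegral_mul_eq_lintegral_mul_lintegral_of_independent_measurableSpace
      (h.history_le (by omega : n ≤ T)) harm.comap_le (hE.arm_indep n hn').symm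
      (f := fun ω => ∏ t ∈ Finset.range n, f (arm t ω)) (g := fun ω => f (arm n ω))
      (Finset.measurable_fun_prod _ fun t ht =>
        hf.comp (measurable_history_arm (Finset.mem_range.1 ht)))
      (hf.comp (comap_measurable _))
    simp only [Finset.prod_range_succ]
    refine (key.trans ?_)
    rw [ih (by omega), pow_succ, ← hE.arm_law n hn', lintegral_map hf harm]

/-- On [0, 1], (1 + z)(1 - z/2) ≥ 1, combined with 1 + z ≤ exp z. -/
theorem exp_neg_le_one_sub_half {z : ℝ} (h0 : 0 ≤ z) (h1 : z ≤ 1) : Real.exp (-z) ≤ 1 - z / 2 := by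
  rw [Real.exp_neg, inv_le_comm₀ (Real.exp_pos z) (by linarith)]
  refine le_trans ?_ (Real.add_one_le_exp z)
  rw [inv_le_iff_one_le_mul₀ (by linarith)]
  nlinarith

theorem lintegral_exp_neg_le [IsProbabilityMeasure ν] (hX : ν Xᶜ = 0)
    (hν : 0 < lamMin (secondMoment ν)) {v : Vec d} {b : ℝ} (hb : 0 < b)
    (hXb : ∀ x ∈ X, (inner ℝ x v) ^ 2 ≤ b) :
    ∫⁻ x, ENNReal.ofReal (Real.exp (-((inner ℝ x v) ^ 2 / b))) ∂ν ≤
      ENNReal.ofReal (Real.exp (-(lamMin (secondMoment ν) * ‖v‖ ^ 2 / (2 * b)))) := by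
  have hint := integrable_inner_sq hν v
  have hint' : Integrable (fun x => 1 - (inner ℝ x v) ^ 2 / b / 2) ν :=
    (integrable_const _).sub ((hint.div_const _).div_const _)
  have hae : ∀ᵐ x ∂ν, x ∈ X := by rw [ae_iff]; exact hX
  have hle : ∀ᵐ x ∂ν, Real.exp (-((inner ℝ x v) ^ 2 / b)) ≤ 1 - (inner ℝ x v) ^ 2 / b / 2 := by
    filter_upwards [hae] with x hx
    exact exp_neg_le_one_sub_half (by positivity) ((div_le_one hb).2 (hXb x hx))
  calc ∫⁻ x, ENNReal.ofReal (Real.exp (-((inner ℝ x v) ^ 2 / b))) ∂ν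
      ≤ ∫⁻ x, ENNReal.ofReal (1 - (inner ℝ x v) ^ 2 / b / 2) ∂ν := by
        refine lintegral_mono_ae ?_
        filter_upwards [hle] with x hx
        exact ENNReal.ofReal_le_ofReal hx
    _ = ENNReal.ofReal (∫ x, (1 - (inner ℝ x v) ^ 2 / b / 2) ∂ν) := by
        rw [ofReal_integral_eq_lintegral_ofReal hint']
        filter_upwards [hle] with x hx
        exact (Real.exp_pos _).le.trans hx
    _ ≤ _ := by
        refine ENNReal.ofReal_le_ofReal ?_
        rw [integral_sub (integrable_const _) ((hint.div_const _).div_const _), integral_div,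
          integral_div]
        simp only [integral_const, probReal_univ, smul_eq_mul, mul_one]
        have h1 := lamMin_mul_le_integral hν v
        have h2 := Real.add_one_le_exp (-(lamMin (secondMoment ν) * ‖v‖ ^ 2 / (2 * b)))
        have h3 : lamMin (secondMoment ν) * ‖v‖ ^ 2 / (2 * b) ≤
            (∫ x, (inner ℝ x v) ^ 2 ∂ν) / b / 2 := by
          rw [div_div, mul_comm b 2]; gcongr
        linarith

/-- A lower tail bound for the empirical second moment in a fixed direction. -/
theorem measure_sum_inner_sq_lt_le [IsProbabilityMeasure μ]
    (h : IsInteraction μ ℱ X θ σ T arm reward)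
    (hE : ExploresAndSelects μ ℱ Q ν t₂ arm reward mhat) (ht₂ : t₂ ≤ T) (hdist : IsDistOn X ν)
    (hν : 0 < lamMin (secondMoment ν)) {K : ℝ} (hK : 0 < K) {v : Vec d}
    (hXK : ∀ x ∈ X, (inner ℝ x v) ^ 2 ≤ K * ‖v‖ ^ 2) :
    μ {ω | ∑ t ∈ Finset.range t₂, (inner ℝ (arm t ω) v) ^ 2 <
        t₂ * lamMin (secondMoment ν) * ‖v‖ ^ 2 / 4} ≤
      ENNReal.ofReal (Real.exp (-(t₂ * lamMin (secondMoment ν) / (4 * K)))) := by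
  have := hdist.1
  set C := lamMin (secondMoment ν) with hC
  rcases eq_or_ne v 0 with rfl | hv
  · simp
  have hv' : 0 < ‖v‖ := norm_pos_iff.2 hv
  have hb : 0 < K * ‖v‖ ^ 2 := by positivity
  set f : Vec d → ℝ≥0∞ := fun x => ENNReal.ofReal (Real.exp (-((inner ℝ x v) ^ 2 / (K * ‖v‖ ^ 2))))
    with hf
  have hfm : Measurable f := by fun_prop
  have h1 := lintegral_prod_arm h hE ht₂ hfm le_rfl
  have h2 : ∫⁻ x, f x ∂ν ≤ ENNReal.ofReal (Real.exp (-(C / (2 * K)))) := by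
    refine (lintegral_exp_neg_le hdist.2 hν hb hXK).trans (le_of_eq ?_)
    rw [← hC]; congr 3; field_simp
  have h3 : ∀ ω, ∏ t ∈ Finset.range t₂, f (arm t ω) = ENNReal.ofReal
      (Real.exp (-((∑ t ∈ Finset.range t₂, (inner ℝ (arm t ω) v) ^ 2) / (K * ‖v‖ ^ 2)))) := by
    intro ω
    rw [hf, ← ENNReal.ofReal_prod_of_nonneg fun _ _ => (Real.exp_pos _).le, ← Real.exp_sum,
      Finset.sum_neg_distrib, Finset.sum_div]
  simp only [h3] at h1
  set c : ℝ := Real.exp (-(t₂ * C / (4 * K))) with hc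
  have hc0 : 0 < c := Real.exp_pos _
  have hmeas : AEMeasurable (fun ω => ENNReal.ofReal
      (Real.exp (-((∑ t ∈ Finset.range t₂, (inner ℝ (arm t ω) v) ^ 2) / (K * ‖v‖ ^ 2))))) μ := by
    simp only [← h3]
    refine Measurable.aemeasurable (Finset.measurable_fun_prod _ fun t ht => hfm.comp ?_)
    exact (h.arm_meas t ((Finset.mem_range.1 ht).trans_le ht₂)).mono (ℱ.le _) le_rfl
  have h4 := mul_meas_ge_le_lintegral₀ hmeas (ENNReal.ofReal c)
  rw [h1] at h4
  -- The expectation is at most c², so Markov's inequality at level c leaves probability c.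
  have h5 : (∫⁻ x, f x ∂ν) ^ t₂ ≤ ENNReal.ofReal c * ENNReal.ofReal c := by
    refine (pow_le_pow_left' h2 t₂).trans (le_of_eq ?_)
    rw [← ENNReal.ofReal_pow (Real.exp_pos _).le, ← Real.exp_nat_mul,
      ← ENNReal.ofReal_mul hc0.le, hc, ← Real.exp_add]
    congr 2; field_simp; ring
  have h6 := (ENNReal.mul_le_mul_iff_right (by simpa using hc0) ENNReal.ofReal_ne_top).1
    (h4.trans h5)
  refine (measure_mono fun ω hω => ?_).trans h6
  refine ENNReal.ofReal_le_ofReal (Real.exp_le_exp.2 (neg_le_neg ?_))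
  rw [div_le_iff₀ hb]
  refine (le_of_lt hω).trans (le_of_eq ?_)
  field_simp

end Chernoff

/-! ### From single directions to a whole subspace. -/

section Net
variable {d : ℕ}

/-- A grid in the unit ball of a subspace. -/
theorem exists_finset_net (m : Submodule ℝ (Vec d)) {k N : ℕ} (hk : Module.finrank ℝ m ≤ k)
    (hN : 0 < N) : ∃ P : Finset (Vec d), P.card ≤ (2 * N + 1) ^ k ∧ (∀ v ∈ P, v ∈ m) ∧
      ∀ u ∈ m, ‖u‖ = 1 → ∃ v ∈ P, ‖u - v‖ ^ 2 ≤ d / (N : ℝ) ^ 2 := by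
  classical
  set b := stdOrthonormalBasis ℝ m with hb
  have hN' : (0 : ℝ) < N := by exact_mod_cast hN
  let g : (Fin (Module.finrank ℝ m) → ℤ) → m := fun c =>
    b.repr.symm (WithLp.toLp 2 fun i => (c i : ℝ) / N)
  let I := Fintype.piFinset fun _ : Fin (Module.finrank ℝ m) => Finset.Icc (-(N : ℤ)) N
  refine ⟨I.image fun c => (g c : Vec d), ?_, ?_, ?_⟩
  · refine Finset.card_image_le.trans ?_
    simp only [I, Fintype.card_piFinset, Int.card_Icc, Finset.prod_const, Finset.card_univ,
      Fintype.card_fin]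
    have : ((N : ℤ) + 1 - -N).toNat = 2 * N + 1 := by omega
    rw [this]
    exact Nat.pow_le_pow_right (by omega) hk
  · intro v hv
    obtain ⟨c, _, rfl⟩ := Finset.mem_image.1 hv
    exact (g c).2
  · intro u hu hu1
    set w := b.repr ⟨u, hu⟩ with hw
    have hw1 : ‖w‖ = 1 := by rw [hw, LinearIsometryEquiv.norm_map]; exact hu1
    have hwi : ∀ i, |w i| ≤ 1 := fun i => by
      have := PiLp.norm_apply_le w i
      rwa [hw1] at this
    -- Rounding down to the grid of mesh 1/N moves each orthonormal coordinate by less than 1/N.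
    let c : Fin (Module.finrank ℝ m) → ℤ := fun i => ⌊N * w i⌋
    refine ⟨g c, Finset.mem_image.2 ⟨c, ?_, rfl⟩, ?_⟩
    · refine Fintype.mem_piFinset.2 fun i => Finset.mem_Icc.2 ⟨?_, ?_⟩
      · rw [Int.le_floor]
        push_cast
        nlinarith [(abs_le.1 (hwi i)).1]
      · refine Int.floor_le_iff.2 ?_
        push_cast
        nlinarith [(abs_le.1 (hwi i)).2]
    · have h1 : ‖u - g c‖ = ‖w - WithLp.toLp 2 fun i => (c i : ℝ) / N‖ := by
        rw [← LinearIsometryEquiv.norm_map b.repr.symm, map_sub, hw,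
          LinearIsometryEquiv.symm_apply_apply]
        rfl
      rw [h1, EuclideanSpace.norm_sq_eq]
      have h2 : ∀ i, ‖(w - WithLp.toLp 2 fun i => (c i : ℝ) / N) i‖ ^ 2 ≤ 1 / (N : ℝ) ^ 2 := by
        intro i
        have h3 : (w - WithLp.toLp 2 fun i => (c i : ℝ) / N) i = Int.fract (N * w i) / N := by
          rw [Int.fract, PiLp.sub_apply]
          simp only [c]
          field_simp
        rw [h3, Real.norm_eq_abs, sq_abs, div_pow]
        gcongr
        exact pow_le_one₀ (Int.fract_nonneg _) (Int.fract_lt_one _).le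
      refine (Finset.sum_le_sum fun i _ => h2 i).trans ?_
      rw [Finset.sum_const, Finset.card_univ, Fintype.card_fin, nsmul_eq_mul, mul_one_div]
      gcongr
      have := Submodule.finrank_le m
      simpa using this

theorem inner_sq_le_of_mem {m : Submodule ℝ (Vec d)} {x v : Vec d} {K : ℝ}
    (hx : ‖m.starProjection x‖ ^ 2 ≤ K) (hv : v ∈ m) : (inner ℝ x v) ^ 2 ≤ K * ‖v‖ ^ 2 := by
  rw [← inner_starProjection_of_mem hv]
  calc (inner ℝ (m.starProjection x) v) ^ 2 = |inner ℝ (m.starProjection x) v| ^ 2 :=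
        (sq_abs _).symm
    _ ≤ (‖m.starProjection x‖ * ‖v‖) ^ 2 := by
        gcongr; exact abs_real_inner_le_norm _ _
    _ ≤ K * ‖v‖ ^ 2 := by rw [mul_pow]; gcongr

/-- For a net point v near a unit vector u, ⟨x,u⟩² ≥ ⟨x,v⟩²/2 - ⟨x,u-v⟩². The main part is at least
nC‖v‖²/8 with ‖v‖² ≥ 31/64, the error at most nC/64; the difference, 23/512 · nC, exceeds nC/32.
Homogeneity does the rest. -/
theorem sum_inner_sq_ge_of_net {m : Submodule ℝ (Vec d)} {K C δ : ℝ} (hK : 0 < K) (hC : 0 < C)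
    (hCK : C ≤ K) (hδ : δ ≤ C / (64 * K)) {n : ℕ} {x : ℕ → Vec d}
    (hx : ∀ t < n, ‖m.starProjection (x t)‖ ^ 2 ≤ K) {P : Finset (Vec d)} (hPm : ∀ v ∈ P, v ∈ m)
    (hP : ∀ u ∈ m, ‖u‖ = 1 → ∃ v ∈ P, ‖u - v‖ ^ 2 ≤ δ)
    (hPx : ∀ v ∈ P, n * C * ‖v‖ ^ 2 / 4 ≤ ∑ t ∈ Finset.range n, (inner ℝ (x t) v) ^ 2)
    {u : Vec d} (hu : u ∈ m) :
    n * C / 32 * ‖u‖ ^ 2 ≤ ∑ t ∈ Finset.range n, (inner ℝ (x t) u) ^ 2 := by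
  have unit : ∀ u ∈ m, ‖u‖ = 1 →
      n * C / 32 ≤ ∑ t ∈ Finset.range n, (inner ℝ (x t) u) ^ 2 := by
    intro u hu hu1
    obtain ⟨v, hv, huv⟩ := hP u hu hu1
    have h1 : 1 / 2 - ‖u - v‖ ^ 2 ≤ ‖v‖ ^ 2 := by
      have h := norm_add_le (u - v) v
      rw [sub_add_cancel, hu1] at h
      nlinarith [sq_nonneg (‖u - v‖ - ‖v‖), norm_nonneg (u - v), norm_nonneg v]
    have h2 : ∑ t ∈ Finset.range n, (inner ℝ (x t) (u - v)) ^ 2 ≤ n * (K * ‖u - v‖ ^ 2) := by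
      calc _ ≤ ∑ t ∈ Finset.range n, K * ‖u - v‖ ^ 2 := Finset.sum_le_sum fun t ht =>
            inner_sq_le_of_mem (hx t (Finset.mem_range.1 ht)) (m.sub_mem hu (hPm v hv))
        _ = _ := by simp
    have h3 : 1 / 2 * ∑ t ∈ Finset.range n, (inner ℝ (x t) v) ^ 2 -
        ∑ t ∈ Finset.range n, (inner ℝ (x t) (u - v)) ^ 2 ≤
        ∑ t ∈ Finset.range n, (inner ℝ (x t) u) ^ 2 := by
      rw [Finset.mul_sum, ← Finset.sum_sub_distrib]
      refine Finset.sum_le_sum fun t _ => ?_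
      rw [inner_sub_right]
      nlinarith [sq_nonneg (2 * inner ℝ (x t) u - inner ℝ (x t) v)]
    have h4 := hPx v hv
    have h5 : K * ‖u - v‖ ^ 2 ≤ C / 64 := by
      calc K * ‖u - v‖ ^ 2 ≤ K * (C / (64 * K)) := by gcongr; exact huv.trans hδ
        _ = C / 64 := by field_simp
    have h6 : ‖u - v‖ ^ 2 ≤ 1 / 64 := by
      refine (huv.trans hδ).trans ?_
      rw [div_le_div_iff₀ (by positivity) (by norm_num)]
      linarith
    have hn : (0 : ℝ) ≤ n := n.cast_nonneg
    have h7 : (n : ℝ) * (K * ‖u - v‖ ^ 2) ≤ n * (C / 64) := by gcongr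
    have h8 : (n : ℝ) * C * (31 / 64) ≤ n * C * ‖v‖ ^ 2 := by gcongr; linarith
    have h9 : 0 ≤ (n : ℝ) * C := by positivity
    linarith
  rcases eq_or_ne u 0 with rfl | hu0
  · simp
  have hu' : ‖u‖ ≠ 0 := norm_ne_zero_iff.2 hu0
  have h := unit (‖u‖⁻¹ • u) (m.smul_mem _ hu) (by simp [norm_smul, hu'])
  simp only [inner_smul_right, mul_pow, ← Finset.mul_sum] at h
  calc _ ≤ (‖u‖⁻¹ ^ 2 * ∑ t ∈ Finset.range n, (inner ℝ (x t) u) ^ 2) * ‖u‖ ^ 2 := by gcongr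
    _ = _ := by field_simp

variable {Ω : Type*} {mΩ : MeasurableSpace Ω} {μ : Measure Ω} {ℱ : Filtration ℕ mΩ}
  {X : Set (Vec d)} {θ : Vec d} {σ : ℝ} {T t₂ : ℕ} {arm : ℕ → Ω → Vec d} {reward : ℕ → Ω → ℝ}
  {Q : Set (Setoid (Fin d))} {ν : Measure (Vec d)} {mhat : Ω → Submodule ℝ (Vec d)}

/-- A lower tail bound for the smallest eigenvalue of the design on a subspace. -/
theorem measure_exists_sum_inner_sq_lt_le [IsProbabilityMeasure μ]
    (h : IsInteraction μ ℱ X θ σ T arm reward)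
    (hE : ExploresAndSelects μ ℱ Q ν t₂ arm reward mhat) (ht₂ : t₂ ≤ T) (hdist : IsDistOn X ν)
    (hν : 0 < lamMin (secondMoment ν)) {K : ℝ} (hK : 0 < K)
    (hCK : lamMin (secondMoment ν) ≤ K) {m : Submodule ℝ (Vec d)}
    (hXK : ∀ x ∈ X, ‖m.starProjection x‖ ^ 2 ≤ K) {k N : ℕ} (hk : Module.finrank ℝ m ≤ k)
    (hN : 0 < N) (hNd : d / (N : ℝ) ^ 2 ≤ lamMin (secondMoment ν) / (64 * K)) :
    μ {ω | ∃ u ∈ m, ∑ t ∈ Finset.range t₂, (inner ℝ (arm t ω) u) ^ 2 <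
        t₂ * lamMin (secondMoment ν) / 32 * ‖u‖ ^ 2} ≤
      ENNReal.ofReal ((2 * N + 1) ^ k *
        Real.exp (-(t₂ * lamMin (secondMoment ν) / (4 * K)))) := by
  obtain ⟨P, hcard, hPm, hP⟩ := exists_finset_net m hk hN
  set B : Vec d → Set Ω := fun v => {ω | ∑ t ∈ Finset.range t₂, (inner ℝ (arm t ω) v) ^ 2 <
        t₂ * lamMin (secondMoment ν) * ‖v‖ ^ 2 / 4} with hB
  have hsub : {ω | ∃ u ∈ m, ∑ t ∈ Finset.range t₂, (inner ℝ (arm t ω) u) ^ 2 <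
        t₂ * lamMin (secondMoment ν) / 32 * ‖u‖ ^ 2} ⊆ ⋃ v ∈ P, B v := by
    rintro ω ⟨u, hu, hlt⟩
    by_contra hcon
    simp only [hB, Set.mem_iUnion, Set.mem_ofPred_eq, not_exists, not_lt] at hcon
    exact hlt.not_ge (sum_inner_sq_ge_of_net hK hν hCK hNd
      (fun t ht => hXK _ (h.arm_mem t (ht.trans_le ht₂) ω)) hPm hP hcon hu)
  calc _ ≤ ∑ v ∈ P, μ (B v) := (measure_mono hsub).trans (measure_biUnion_finset_le _ _)
    _ ≤ ∑ v ∈ P, ENNReal.ofReal (Real.exp (-(t₂ * lamMin (secondMoment ν) / (4 * K)))) :=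
        Finset.sum_le_sum fun v hv => measure_sum_inner_sq_lt_le h hE ht₂ hdist hν hK
          fun x hx => inner_sq_le_of_mem (hXK x hx) (hPm v hv)
    _ ≤ _ := by
        rw [Finset.sum_const, nsmul_eq_mul, ENNReal.ofReal_mul (by positivity)]
        gcongr
        rw [← ENNReal.ofReal_natCast]
        refine ENNReal.ofReal_le_ofReal ?_
        exact_mod_cast hcard

end Net

/-! ### Counting, dimension and separation of the models. -/

section Models
variable {d : ℕ} {Q : Set (Setoid (Fin d))}

theorem finite_setoids : (Set.univ : Set (Setoid (Fin d))).Finite := by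
  classical
  refine Set.Finite.of_finite_image (f := fun p : Setoid (Fin d) => fun i j => p i j)
    (Set.toFinite _) ?_
  intro p _ q _ h
  ext i j
  exact iff_of_eq (congrFun (congrFun h i) j)

theorem fixedSubspace_eq_of_orbitPartition_eq {G H : Subgroup (Equiv.Perm (Fin d))}
    (h : orbitPartition G = orbitPartition H) : fixedSubspace G = fixedSubspace H := by
  ext x
  rw [mem_fixedSubspace_iff, mem_fixedSubspace_iff, h]

/-- Many groups share one orbit partition, hence one fixed subspace; choosing a group for each model
embeds the models into `Q`. -/
theorem finite_models_and_ncard_le : (models Q).Finite ∧ (models Q).ncard ≤ Q.ncard := by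
  classical
  choose! f hf using fun (m : Submodule ℝ (Vec d)) (hm : m ∈ models Q) => hm
  have hmaps : ∀ m ∈ models Q, orbitPartition (f m) ∈ Q := fun m hm => (hf m hm).1
  have hinj : Set.InjOn (fun m => orbitPartition (f m)) (models Q) := by
    intro m hm m' hm' h
    rw [(hf m hm).2, (hf m' hm').2]
    exact fixedSubspace_eq_of_orbitPartition_eq h
  have hQ : Q.Finite := finite_setoids.subset (Set.subset_univ _)
  exact ⟨Set.Finite.of_finite_image (hQ.subset (Set.image_subset_iff.2 hmaps)) hinj,
    Set.ncard_le_ncard_of_injOn _ hmaps hinj hQ⟩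

/-- A fixed vector is determined by its values at one representative of each class. -/
theorem finrank_fixedSubspace_le (H : Subgroup (Equiv.Perm (Fin d))) :
    Module.finrank ℝ (fixedSubspace H) ≤ numClasses (orbitPartition H) := by
  classical
  let p := orbitPartition H
  let f : fixedSubspace H →ₗ[ℝ] (Quotient p → ℝ) :=
    { toFun := fun x q => (x : Vec d) q.out
      map_add' := fun _ _ => rfl
      map_smul' := fun _ _ => rfl }
  have hf : Function.Injective f := by
    intro x y hxy
    ext i
    have hr : p (Quotient.mk p i).out i := Quotient.mk_out i
    rw [← (mem_fixedSubspace_iff H _).1 x.2 _ _ hr, ← (mem_fixedSubspace_iff H _).1 y.2 _ _ hr]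
    exact congrFun hxy (Quotient.mk p i)
  have := LinearMap.finrank_le_finrank_of_injective hf
  rw [numClasses, Nat.card_eq_fintype_card]
  simpa using this

theorem finrank_le_of_mem_models {d₀ : ℕ} (hQ : ∀ p ∈ Q, numClasses p ≤ d₀)
    {m : Submodule ℝ (Vec d)} (hm : m ∈ models Q) : Module.finrank ℝ m ≤ d₀ := by
  obtain ⟨H, hH, rfl⟩ := hm
  exact (finrank_fixedSubspace_le H).trans (hQ _ hH)

theorem finrank_sup_le_of_mem_models {d₀ : ℕ} (hQ : ∀ p ∈ Q, numClasses p ≤ d₀)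
    {m m' : Submodule ℝ (Vec d)} (hm : m ∈ models Q) (hm' : m' ∈ models Q) :
    Module.finrank ℝ (m ⊔ m' : Submodule ℝ (Vec d)) ≤ 2 * d₀ := by
  have h := Submodule.finrank_sup_add_finrank_inf_eq m m'
  have h1 := finrank_le_of_mem_models hQ hm
  have h2 := finrank_le_of_mem_models hQ hm'
  omega

theorem mem_extendedModels_of_mem_models {m : Submodule ℝ (Vec d)} (hm : m ∈ models Q) :
    m ∈ extendedModels Q := ⟨m, hm, m, hm, (sup_idem m).symm⟩

theorem one_le_numClasses (hd : 1 ≤ d) (p : Setoid (Fin d)) : 1 ≤ numClasses p := by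
  have : Nonempty (Quotient p) := ⟨Quotient.mk p ⟨0, hd⟩⟩
  exact Nat.one_le_iff_ne_zero.2 Nat.card_pos.ne'

/-- Each of the d₀ class sizes contributes at most |A| d^(|c| d₀). The factors d₀ and |A| go into
the exponent by log(dT) ≥ log 2 ≥ 1/2, which gives the summands 1 and 2|A|. -/
theorem ncard_le_exp {d₀ T : ℕ} {A c : ℝ} (hd : 1 ≤ d) (hT : 2 ≤ T) (hd₀ : 1 ≤ d₀)
    (hQ : SubexponentialPartitions Q d₀ A c) :
    (Q.ncard : ℝ) ≤ Real.exp ((1 + |c| + 2 * |A|) * d₀ * Real.log (d * T)) := by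
  classical
  have hd' : (1 : ℝ) ≤ d := by exact_mod_cast hd
  have hT' : (2 : ℝ) ≤ T := by exact_mod_cast hT
  have hd₀' : (1 : ℝ) ≤ d₀ := by exact_mod_cast hd₀
  set L := Real.log (d * T) with hL
  have hlog2 : (1 : ℝ) / 2 ≤ Real.log 2 := by linarith [Real.log_two_gt_d9]
  have hL2 : Real.log 2 ≤ L := Real.log_le_log (by norm_num) (by nlinarith)
  have hLd : Real.log d ≤ L := Real.log_le_log (by linarith) (by nlinarith)
  have hfin : Q.Finite := finite_setoids.subset (Set.subset_univ _)
  have h1 : Q.ncard = ∑ k ∈ Finset.Icc 1 d₀, {p ∈ Q | numClasses p = k}.ncard := by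
    rw [Set.ncard_eq_toFinset_card Q hfin, Finset.card_eq_sum_card_fiberwise
      (f := numClasses) (t := Finset.Icc 1 d₀)]
    · refine Finset.sum_congr rfl fun k _ => ?_
      rw [← Set.ncard_coe_finset]
      congr 1
      ext p
      simp
    · intro p hp
      rw [Finset.mem_coe, Set.Finite.mem_toFinset] at hp
      exact Finset.mem_coe.2 (Finset.mem_Icc.2 ⟨one_le_numClasses hd p, hQ.1 p hp⟩)
  have h2 : ∀ k ∈ Finset.Icc 1 d₀, (({p ∈ Q | numClasses p = k}.ncard : ℕ) : ℝ) ≤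
      |A| * Real.exp (|c| * d₀ * L) := by
    intro k hk
    rw [Finset.mem_Icc] at hk
    refine (hQ.2 k hk.1 hk.2).trans ?_
    have hk' : (k : ℝ) ≤ d₀ := by exact_mod_cast hk.2
    have h3 : (d : ℝ) ^ (c * (k : ℝ)) ≤ Real.exp (|c| * d₀ * L) := by
      rw [Real.rpow_def_of_pos (by linarith)]
      refine Real.exp_le_exp.2 ?_
      have hlog : 0 ≤ Real.log d := Real.log_nonneg hd'
      calc Real.log d * (c * k) ≤ Real.log d * (|c| * d₀) := by
            refine mul_le_mul_of_nonneg_left ?_ hlog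
            calc c * k ≤ |c| * k := by gcongr; exact le_abs_self c
              _ ≤ |c| * d₀ := by gcongr
        _ ≤ L * (|c| * d₀) := by gcongr
        _ = _ := by ring
    calc A * (d : ℝ) ^ (c * (k : ℝ)) ≤ |A| * (d : ℝ) ^ (c * (k : ℝ)) := by
          gcongr; exact le_abs_self A
      _ ≤ _ := by gcongr
  have h4 : (d₀ : ℝ) ≤ Real.exp (d₀ * L) := by
    have h5 : (d₀ : ℝ) ≤ 2 ^ d₀ := by exact_mod_cast (Nat.lt_two_pow_self).le
    refine h5.trans ?_
    rw [← Real.rpow_natCast, Real.rpow_def_of_pos (by norm_num)]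
    refine Real.exp_le_exp.2 ?_
    rw [mul_comm]; gcongr
  have h6 : |A| ≤ Real.exp (2 * |A| * d₀ * L) := by
    have h7 := Real.add_one_le_exp |A|
    refine (le_trans (by linarith) h7).trans (Real.exp_le_exp.2 ?_)
    have h8 : 1 / 2 ≤ d₀ * L := by nlinarith
    nlinarith [abs_nonneg A]
  rw [h1]
  push_cast
  calc _ ≤ ∑ k ∈ Finset.Icc 1 d₀, |A| * Real.exp (|c| * d₀ * L) := Finset.sum_le_sum h2
    _ = d₀ * (|A| * Real.exp (|c| * d₀ * L)) := by simp
    _ ≤ Real.exp (d₀ * L) * (Real.exp (2 * |A| * d₀ * L) * Real.exp (|c| * d₀ * L)) := by gcongr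
    _ = _ := by
      rw [← Real.exp_add, ← Real.exp_add]; congr 1; ring

/-- A model that does not contain `θ` is far from it. -/
theorem sq_le_norm_sub_sq_of_notMem {G : Subgroup (Equiv.Perm (Fin d))} {θ : Vec d} {ε : ℝ}
    (hε : 0 < ε) (hθ : θ ∈ fixedSubspace G) (hsep : WellSeparated G θ ε)
    {m : Submodule ℝ (Vec d)} (hm : m ∈ models Q) (hθm : θ ∉ m) {v : Vec d} (hv : v ∈ m) :
    ε ^ 2 / 2 ≤ ‖v - θ‖ ^ 2 := by
  obtain ⟨H, -, rfl⟩ := hm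
  rw [mem_fixedSubspace_iff] at hθ hθm hv
  push Not at hθm
  -- The model joins i and j while θ distinguishes them, so they lie in different `G`-orbits and θ
  -- has a gap ε there. The common value of v at i and j does best at the midpoint, with squared
  -- error ε²/2.
  obtain ⟨i, j, hij, hne⟩ := hθm
  have h1 : ε ≤ |θ i - θ j| := hsep i j fun h => hne (hθ i j h)
  have hij' : i ≠ j := fun h => hne (h ▸ rfl)
  have h2 : (v i - θ i) ^ 2 + (v j - θ j) ^ 2 ≤ ‖v - θ‖ ^ 2 := by
    rw [EuclideanSpace.norm_sq_eq, ← Finset.sum_pair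
      (f := fun i => (v i - θ i) ^ 2) hij']
    refine (Finset.sum_le_univ_sum_of_nonneg (fun i => sq_nonneg _)).trans (le_of_eq ?_)
    refine Finset.sum_congr rfl fun k _ => ?_
    rw [Real.norm_eq_abs, sq_abs, PiLp.sub_apply]
  have h3 : ε ^ 2 ≤ (θ i - θ j) ^ 2 := by
    rw [← sq_abs (θ i - θ j)]; gcongr
  have h4 := hv i j hij
  refine le_trans ?_ h2
  rw [h4]
  nlinarith [sq_nonneg ((v j - θ i) + (v j - θ j))]

/-- The all-ones vector lies in every fixed subspace, so it can test the second moment against the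
bound on projected arms. Hence K/C ≥ 1 in all later estimates. -/
theorem lamMin_le_of_boundedArms {X : Set (Vec d)} {θ : Vec d} {K R : ℝ} {ν : Measure (Vec d)}
    (hd : 1 ≤ d) (hB : BoundedArms X Q θ K R) {m : Submodule ℝ (Vec d)} (hm : m ∈ models Q)
    (hdist : IsDistOn X ν) (hν : 0 < lamMin (secondMoment ν)) :
    lamMin (secondMoment ν) ≤ K := by
  have := hdist.1
  set v : Vec d := WithLp.toLp 2 fun _ => 1 with hv
  have hvm : v ∈ m := by
    obtain ⟨H, -, rfl⟩ := hm
    exact (mem_fixedSubspace_iff H v).2 fun _ _ _ => rfl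
  have hv0 : 0 < ‖v‖ ^ 2 := by
    have : v ≠ 0 := fun h => by simpa [hv] using congrArg (fun w : Vec d => w ⟨0, hd⟩) h
    positivity
  have hae : ∀ᵐ x ∂ν, x ∈ X := by rw [ae_iff]; exact hdist.2
  have h1 : ∫ x, (inner ℝ x v) ^ 2 ∂ν ≤ K * ‖v‖ ^ 2 := by
    calc _ ≤ ∫ x, K * ‖v‖ ^ 2 ∂ν := by
          refine integral_mono_ae (integrable_inner_sq hν v) (integrable_const _) ?_
          filter_upwards [hae] with x hx
          exact inner_sq_le_of_mem ((hB x hx).1 m (mem_extendedModels_of_mem_models hm)) hvm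
      _ = _ := by simp
  exact le_of_mul_le_mul_right ((lamMin_mul_le_integral hν v).trans h1) hv0

end Models

/-! ### Residuals and the basic inequality of least squares. -/

section LeastSquares
variable {d n : ℕ} {m : Submodule ℝ (Vec d)} {x : Fin n → Vec d}

theorem mem_colSpace_iff {w : Vec n} :
    w ∈ colSpace m x ↔ ∃ v ∈ m, ∀ t, w t = inner ℝ (x t) v := by
  have key : ∀ (c : Vec d) (t : Fin n), (∑ j, c j •
      (WithLp.toLp 2 (fun t : Fin n => m.starProjection (x t) j) : Vec n)) t =
        inner ℝ (m.starProjection (x t)) c := by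
    intro c t
    rw [← dotProduct_eq_inner, dotProduct]
    simp [mul_comm]
  rw [colSpace, Submodule.mem_span_range_iff_exists_fun]
  constructor
  · rintro ⟨c, rfl⟩
    refine ⟨m.starProjection (WithLp.toLp 2 c), Submodule.starProjection_apply_mem _ _,
      fun t => ?_⟩
    rw [← Submodule.inner_starProjection_left_eq_right]
    exact key (WithLp.toLp 2 c) t
  · rintro ⟨v, hv, h⟩
    refine ⟨v, ?_⟩
    ext t
    rw [h t, ← inner_starProjection_of_mem hv]
    exact key v t

theorem residual_le_sum {v : Vec d} (hv : v ∈ m) (y : Fin n → ℝ) :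
    residual m x y ≤ ∑ t, (y t - inner ℝ (x t) v) ^ 2 := by
  set w : Vec n := WithLp.toLp 2 fun t => inner ℝ (x t) v with hw
  have hwm : w ∈ colSpace m x := mem_colSpace_iff.2 ⟨v, hv, fun t => rfl⟩
  have h1 : ‖(WithLp.toLp 2 y : Vec n) - (colSpace m x).starProjection (WithLp.toLp 2 y)‖ ≤
      ‖(WithLp.toLp 2 y : Vec n) - w‖ := by
    rw [Submodule.starProjection_minimal]
    exact ciInf_le ⟨0, by rintro _ ⟨z, rfl⟩; exact norm_nonneg _⟩
      (⟨w, hwm⟩ : colSpace m x)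
  calc residual m x y ≤ ‖(WithLp.toLp 2 y : Vec n) - w‖ ^ 2 := by
        unfold residual; gcongr
    _ = _ := by
        rw [EuclideanSpace.norm_sq_eq]
        refine Finset.sum_congr rfl fun t _ => ?_
        rw [Real.norm_eq_abs, sq_abs, PiLp.sub_apply]

theorem exists_residual_eq_sum (y : Fin n → ℝ) :
    ∃ v ∈ m, residual m x y = ∑ t, (y t - inner ℝ (x t) v) ^ 2 := by
  obtain ⟨v, hv, h⟩ := mem_colSpace_iff.1
    (Submodule.starProjection_apply_mem (colSpace m x) (WithLp.toLp 2 y))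
  refine ⟨v, hv, ?_⟩
  rw [residual, EuclideanSpace.norm_sq_eq]
  refine Finset.sum_congr rfl fun t _ => ?_
  rw [Real.norm_eq_abs, sq_abs, PiLp.sub_apply, h t]

/-- The basic inequality of least squares. -/
theorem exists_sum_inner_sq_le_of_residual_le {m' : Submodule ℝ (Vec d)} {θ : Vec d}
    (hθ : θ ∈ m') {y : Fin n → ℝ} (h : residual m x y ≤ residual m' x y) :
    ∃ v ∈ m, ∑ t, (inner ℝ (x t) (v - θ)) ^ 2 ≤
      2 * ∑ t, (y t - inner ℝ (x t) θ) * inner ℝ (x t) (v - θ) := by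
  obtain ⟨v, hv, hres⟩ := exists_residual_eq_sum (m := m) (x := x) y
  refine ⟨v, hv, ?_⟩
  have h1 := (hres ▸ h).trans (residual_le_sum hθ y)
  rw [Finset.mul_sum, ← sub_nonpos, ← Finset.sum_sub_distrib]
  rw [← sub_nonpos, ← Finset.sum_sub_distrib] at h1
  refine le_trans (le_of_eq ?_) h1
  refine Finset.sum_congr rfl fun t _ => ?_
  rw [inner_sub_right]
  ring

end LeastSquares

/-! ### From a small mixture to a self-normalized noise bound. -/

section SelfNormalized
variable {d : ℕ} {Ω : Type*} {m : Submodule ℝ (Vec d)} {lam σ : ℝ} {θ : Vec d}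
  {arm : ℕ → Ω → Vec d} {reward : ℕ → Ω → ℝ}

theorem noiseSum_dotProduct {v : Vec d} (hv : v ∈ m) (a t : ℕ) (ω : Ω) :
    noiseSum m θ arm reward a t ω ⬝ᵥ v.ofLp =
      ∑ s ∈ Finset.Ico a t, noise θ arm reward s ω * inner ℝ (arm s ω) v := by
  rw [noiseSum, sum_dotProduct]
  refine Finset.sum_congr rfl fun s _ => ?_
  rw [smul_dotProduct, dotProduct_eq_inner, inner_starProjection_of_mem hv, smul_eq_mul]

theorem quadForm_lt_of_mixture_lt (hlam : 0 < lam) (hσ : 0 < σ) {c : ℝ} (hc : 0 < c) {a t : ℕ}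
    {ω : Ω} (h : mixture m lam σ θ arm reward a t ω < c) :
    noiseSum m θ arm reward a t ω ⬝ᵥ
      ((gram m lam (Finset.Ico a t) fun s => arm s ω)⁻¹ *ᵥ noiseSum m θ arm reward a t ω) <
    2 * σ ^ 2 * Real.log
      (√((gram m lam (Finset.Ico a t) fun s => arm s ω).det / lam ^ d) * c) := by
  have hdet : 0 < √((gram m lam (Finset.Ico a t) fun s => arm s ω).det / lam ^ d) :=
    Real.sqrt_pos.2 (div_pos (gram_det_pos m _ _ hlam) (by positivity))
  rw [mixture, inv_mul_lt_iff₀ hdet, ← Real.lt_log_iff_exp_lt (by positivity),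
    div_lt_iff₀ (by positivity)] at h
  linarith

end SelfNormalized

/-! ### Correctness of the selected model. -/

section Selection
variable {d : ℕ} {Ω : Type*} {mΩ : MeasurableSpace Ω} {μ : Measure Ω} {ℱ : Filtration ℕ mΩ}
  {X : Set (Vec d)} {θ : Vec d} {σ : ℝ} {T t₂ : ℕ} {arm : ℕ → Ω → Vec d} {reward : ℕ → Ω → ℝ}
  {Q : Set (Setoid (Fin d))} {ν : Measure (Vec d)} {mhat : Ω → Submodule ℝ (Vec d)}

/-- A selected model is correct if the design is well-conditioned and the noise is small on the
sum of the selected and the true model. -/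
theorem mem_of_isSelected {G : Subgroup (Equiv.Perm (Fin d))} {ε K C c : ℝ} {d₀ : ℕ}
    (hσ : 0 < σ) (hε : 0 < ε) (hC : 0 < C) (hK : 0 < K) (ht₂ : 0 < t₂)
    (hθ : θ ∈ fixedSubspace G) (hG : orbitPartition G ∈ Q) (hsep : WellSeparated G θ ε)
    (hQ : ∀ p ∈ Q, numClasses p ≤ d₀) (hc : 0 < c) {ω : Ω} {m : Submodule ℝ (Vec d)}
    (hsel : IsSelected Q (fun t : Fin t₂ => arm t ω) (fun t : Fin t₂ => reward t ω) m)
    (hXK : ∀ t < t₂, ‖(m ⊔ fixedSubspace G).starProjection (arm t ω)‖ ^ 2 ≤ K)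
    (hgram : ∀ u ∈ m ⊔ fixedSubspace G,
      t₂ * C / 32 * ‖u‖ ^ 2 ≤ ∑ t ∈ Finset.range t₂, (inner ℝ (arm t ω) u) ^ 2)
    (hmix : mixture (m ⊔ fixedSubspace G) (t₂ * C / 32) σ θ arm reward 0 t₂ ω < c)
    (hlarge : 16 * σ ^ 2 * (d₀ * Real.log (1 + 32 * K / C) + Real.log c) ≤
      t₂ * C * ε ^ 2 / 64) : θ ∈ m := by
  by_contra hθm
  have hGm : fixedSubspace G ∈ models Q := ⟨G, hG, rfl⟩
  set M := m ⊔ fixedSubspace G with hM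
  set lam := t₂ * C / 32 with hlam
  have ht₂' : (0 : ℝ) < t₂ := by exact_mod_cast ht₂
  have hlam0 : 0 < lam := by positivity
  obtain ⟨v, hv, hls⟩ := exists_sum_inner_sq_le_of_residual_le hθ (hsel.2 _ hGm)
  set u := v - θ with hu
  have huM : u ∈ M := M.sub_mem (Submodule.mem_sup_left hv) (Submodule.mem_sup_right hθ)
  rw [Fin.sum_univ_eq_sum_range (fun t => (inner ℝ (arm t ω) u) ^ 2),
    Fin.sum_univ_eq_sum_range
      (fun t => (reward t ω - inner ℝ (arm t ω) θ) * inner ℝ (arm t ω) u)] at hls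
  set S := ∑ t ∈ Finset.range t₂, (inner ℝ (arm t ω) u) ^ 2 with hS
  set V := gram M lam (Finset.Ico 0 t₂) fun s => arm s ω with hVdef
  set q := noiseSum M θ arm reward 0 t₂ ω ⬝ᵥ (V⁻¹ *ᵥ noiseSum M θ arm reward 0 t₂ ω) with hq
  have hV : V.PosDef := gram_posDef M _ _ hlam0
  have hq0 : 0 ≤ q := quadForm_nonneg hV.inv.posSemidef _
  have h1 : S ≤ 2 * (√q * √(u.ofLp ⬝ᵥ (V *ᵥ u.ofLp))) := by
    refine hls.trans ?_
    have h := dotProduct_le_sqrt_mul_sqrt hV (noiseSum M θ arm reward 0 t₂ ω) u.ofLp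
    rw [noiseSum_dotProduct huM, ← Finset.range_eq_Ico] at h
    exact mul_le_mul_of_nonneg_left h (by norm_num)
  have hlower := hgram u huM
  -- The regularization equals the curvature guaranteed by the design, so it at most doubles the
  -- quadratic form.
  have h2 : u.ofLp ⬝ᵥ (V *ᵥ u.ofLp) ≤ 2 * S := by
    rw [hVdef, gram_quadForm, ← Finset.range_eq_Ico]
    simp only [inner_starProjection_of_mem huM]
    linarith
  have hdist := sq_le_norm_sub_sq_of_notMem hε hθ hsep hsel.1 hθm hv
  have hSpos : 0 < S := by
    refine lt_of_lt_of_le ?_ hlower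
    have : 0 < ‖u‖ ^ 2 := lt_of_lt_of_le (by positivity) hdist
    positivity
  have h3 : S ≤ 8 * q := by
    have h4 : S ≤ 2 * √(q * (2 * S)) := by
      rw [Real.sqrt_mul hq0]
      refine h1.trans ?_
      gcongr
    have h5 : S ^ 2 ≤ 4 * (q * (2 * S)) := by
      calc S ^ 2 ≤ (2 * √(q * (2 * S))) ^ 2 := by gcongr
        _ = _ := by rw [mul_pow, Real.sq_sqrt (by positivity)]; norm_num
    nlinarith
  have hqlt := quadForm_lt_of_mixture_lt hlam0 hσ hc hmix
  rw [← hVdef, ← hq] at hqlt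
  have hlog : Real.log (√(V.det / lam ^ d) * c) ≤
      d₀ * Real.log (1 + 32 * K / C) + Real.log c := by
    have hdet : 0 < V.det / lam ^ d := div_pos hV.det_pos (by positivity)
    have h6 := gram_det_div_le M (Finset.Ico 0 t₂) (fun s => arm s ω) hlam0
      (finrank_sup_le_of_mem_models hQ hsel.1 hGm) hK.le (n := t₂) (by simp)
      (fun s hs => hXK s (Finset.mem_Ico.1 hs).2)
    -- With `lam` proportional to t₂, the determinant bound no longer depends on t₂. Its exponent
    -- 2d₀ is halved by the square root below.
    have h7 : (t₂ : ℝ) * K / lam = 32 * K / C := by rw [hlam]; field_simp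
    rw [← hVdef, h7] at h6
    rw [Real.log_mul (Real.sqrt_pos.2 hdet).ne' hc.ne', Real.log_sqrt hdet.le]
    have h8 := Real.log_le_log hdet h6
    rw [Real.log_pow] at h8
    push_cast at h8
    linarith
  have h9 : 8 * q < 16 * σ ^ 2 * (d₀ * Real.log (1 + 32 * K / C) + Real.log c) := by
    have : 2 * σ ^ 2 * Real.log (√(V.det / lam ^ d) * c) ≤
        2 * σ ^ 2 * (d₀ * Real.log (1 + 32 * K / C) + Real.log c) := by gcongr
    linarith
  have h10 : t₂ * C * ε ^ 2 / 64 ≤ S := by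
    refine le_trans ?_ hlower
    rw [hlam]
    have : t₂ * C / 32 * (ε ^ 2 / 2) ≤ t₂ * C / 32 * ‖u‖ ^ 2 := by gcongr
    linarith
  linarith

/-- The exponent of the number of models. -/
def modelExponent (A c : ℝ) : ℝ := 1 + |c| + 2 * |A|

/-- The factor in front of the exploration rate. -/
def exploreFactor (A c κ : ℝ) : ℝ := (|κ| + 1) ^ 2 * (1024 * (9 + modelExponent A c))

theorem modelExponent_pos (A c : ℝ) : 0 < modelExponent A c := by
  unfold modelExponent; positivity

theorem exploreFactor_pos (A c κ : ℝ) : 0 < exploreFactor A c κ := by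
  have := modelExponent_pos A c
  unfold exploreFactor; positivity

/-- What the length of the exploration phase says about the other parameters. -/
theorem explore_bounds {A c κ K C ε : ℝ} {d₀ n : ℕ} (hd : 1 ≤ d) (hT : 2 ≤ T) (hn : n ≤ T)
    (hd₀ : 1 ≤ d₀) (hσ : 0 < σ) (hK : 1 ≤ K) (hC : 0 < C) (hCK : C ≤ K) (hε : 0 < ε)
    (hεκ : ε ≤ κ * σ)
    (hrate : exploreFactor A c κ * exploreRate σ K C ε d d₀ T ≤ n) :
    1024 * (9 + modelExponent A c) * (K / C) * (d₀ * Real.log (d * T)) ≤ n ∧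
    1024 * (9 + modelExponent A c) * σ ^ 2 * (d₀ * Real.log (d * T)) ≤ n * C * ε ^ 2 ∧
    K / C ≤ T ∧ (d₀ : ℝ) * Real.log (d * T) ≤ (|κ| + 1) ^ 2 * exploreRate σ K C ε d d₀ T := by
  have ha := modelExponent_pos A c
  set a := modelExponent A c
  have hd' : (1 : ℝ) ≤ d := by exact_mod_cast hd
  have hT' : (2 : ℝ) ≤ T := by exact_mod_cast hT
  have hn' : (n : ℝ) ≤ T := by exact_mod_cast hn
  have hd₀' : (1 : ℝ) ≤ d₀ := by exact_mod_cast hd₀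
  have hL2 : Real.log 2 ≤ Real.log (d * T) := Real.log_le_log (by norm_num) (by nlinarith)
  have hlog2 : (1 : ℝ) / 2 ≤ Real.log 2 := by linarith [Real.log_two_gt_d9]
  set L := Real.log (d * T)
  have hDL : 1 / 2 ≤ d₀ * L := by nlinarith
  have hρ : 1 ≤ K / C := (one_le_div hC).2 hCK
  have hκσ : ε ≤ (|κ| + 1) * σ := hεκ.trans (by gcongr; linarith [le_abs_self κ])
  have hratio : 1 ≤ (|κ| + 1) ^ 2 * (σ ^ 2 / ε ^ 2) := by
    rw [← mul_div_assoc, one_le_div (by positivity), ← mul_pow]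
    gcongr
  have hE : exploreRate σ K C ε d d₀ T = (σ ^ 2 / ε ^ 2) * ((K / C) ^ 2 * (d₀ * L)) := by
    unfold exploreRate; field_simp; rfl
  have h4 : (K / C) ^ 2 * (d₀ * L) ≤ (|κ| + 1) ^ 2 * exploreRate σ K C ε d d₀ T := by
    rw [hE]
    calc _ ≤ (|κ| + 1) ^ 2 * (σ ^ 2 / ε ^ 2) * ((K / C) ^ 2 * (d₀ * L)) :=
          le_mul_of_one_le_left (by positivity) hratio
      _ = _ := by ring
  have hρ2 : K / C ≤ (K / C) ^ 2 := by nlinarith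
  have h5 : 1024 * (9 + a) * ((K / C) ^ 2 * (d₀ * L)) ≤ n := by
    refine le_trans ?_ hrate
    calc _ ≤ 1024 * (9 + a) * ((|κ| + 1) ^ 2 * exploreRate σ K C ε d d₀ T) := by gcongr
      _ = _ := by rw [exploreFactor]; ring
  refine ⟨?_, ?_, ?_, ?_⟩
  · refine le_trans ?_ h5
    calc _ = 1024 * (9 + a) * ((K / C) * (d₀ * L)) := by ring
      _ ≤ _ := by gcongr
  · have h6 : 1024 * (9 + a) * ((σ ^ 2 / ε ^ 2) * ((K / C) ^ 2 * (d₀ * L))) ≤ n := by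
      refine le_trans ?_ hrate
      rw [hE, exploreFactor]
      have h7 : (1 : ℝ) ≤ (|κ| + 1) ^ 2 := one_le_pow₀ (by linarith [abs_nonneg κ])
      rw [mul_assoc ((|κ| + 1) ^ 2)]
      exact le_mul_of_one_le_left (by positivity) h7
    -- The product equals (K/C)K, and both factors are at least 1.
    have h8 : 1 ≤ (K / C) ^ 2 * C := by
      have : (K / C) ^ 2 * C = (K / C) * K := by field_simp
      rw [this]; nlinarith
    calc 1024 * (9 + a) * σ ^ 2 * (d₀ * L)
        ≤ 1024 * (9 + a) * σ ^ 2 * (d₀ * L) * ((K / C) ^ 2 * C) :=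
          le_mul_of_one_le_right (by positivity) h8
      _ = 1024 * (9 + a) * ((σ ^ 2 / ε ^ 2) * ((K / C) ^ 2 * (d₀ * L))) * C * ε ^ 2 := by
          field_simp
      _ ≤ n * C * ε ^ 2 := by gcongr
  -- Exploration fits into the horizon, so its length, which dominates (K/C)², is at most T.
  · refine hρ2.trans (le_trans ?_ (h5.trans hn'))
    calc (K / C) ^ 2 = 2 * ((K / C) ^ 2 * (1 / 2)) := by ring
      _ ≤ 1024 * (9 + a) * ((K / C) ^ 2 * (d₀ * L)) := by
          gcongr
          linarith
  · refine le_trans ?_ h4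
    exact le_mul_of_one_le_left (by positivity) (one_le_pow₀ hρ)

theorem two_mul_eight_mul_add_one_le {q : ℝ} (hq : 2 ≤ q) :
    2 * (8 * q) + 1 ≤ Real.exp (6 * Real.log q) := by
  have h2 : Real.exp (6 * Real.log q) = q ^ 5 * q := by
    rw [← pow_succ, ← Real.exp_log (by linarith : 0 < q), ← Real.exp_nat_mul,
      Real.exp_log (by linarith)]
    norm_num
  have h3 : (2 : ℝ) ^ 5 ≤ q ^ 5 := by gcongr
  rw [h2]
  calc 2 * (8 * q) + 1 ≤ 2 ^ 5 * q := by linarith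
    _ ≤ q ^ 5 * q := by gcongr

theorem exp_neg_two_mul_log_le {q T : ℝ} (hT : 0 < T) (hq : 2 ≤ q) (hTq : T ≤ q) :
    Real.exp (-(2 * Real.log q)) ≤ 1 / (2 * T) := by
  rw [Real.exp_neg, ← one_div]
  apply one_div_le_one_div_of_le (by positivity)
  have h8 : Real.exp (2 * Real.log q) = q * q := by
    rw [two_mul, Real.exp_add, Real.exp_log (by linarith)]
  rw [h8]
  exact mul_le_mul hq hTq hT.le (by linarith)

/-- Two failures are possible for each model m: a badly conditioned design on m + Fix_G (`E₁`) or a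
large mixture there (`E₂`). Writing L = log(dT) and a for `modelExponent`, each is allotted exp(-a
d₀ L)/(2T), which the at most exp(a d₀ L) models sum to 1/T. -/
theorem measure_notMem_le [IsProbabilityMeasure μ] {A c κ K R ε : ℝ} {d₀ : ℕ}
    {G : Subgroup (Equiv.Perm (Fin d))} (hd : 1 ≤ d) (hT : 2 ≤ T) (ht₂ : t₂ ≤ T) (hσ : 0 < σ)
    (hK : 1 ≤ K) (hε : 0 < ε) (hεκ : ε ≤ κ * σ) (hθ : θ ∈ fixedSubspace G)
    (hG : orbitPartition G ∈ Q) (hQ : SubexponentialPartitions Q d₀ A c)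
    (hB : BoundedArms X Q θ K R) (hsep : WellSeparated G θ ε) (hdist : IsDistOn X ν)
    (hν : 0 < lamMin (secondMoment ν)) (hI : IsInteraction μ ℱ X θ σ T arm reward)
    (hE : ExploresAndSelects μ ℱ Q ν t₂ arm reward mhat)
    (hrate : exploreFactor A c κ * exploreRate σ K (lamMin (secondMoment ν)) ε d d₀ T ≤ t₂) :
    μ {ω | θ ∉ mhat ω} ≤ ENNReal.ofReal (1 / T) := by
  classical
  have hGm : fixedSubspace G ∈ models Q := ⟨G, hG, rfl⟩
  have hd₀ : 1 ≤ d₀ := (one_le_numClasses hd _).trans (hQ.1 _ hG)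
  have hCK := lamMin_le_of_boundedArms hd hB hGm hdist hν
  set C := lamMin (secondMoment ν) with hC
  have hK0 : 0 < K := by linarith
  obtain ⟨hb1, hb2, hρT, -⟩ := explore_bounds hd hT ht₂ hd₀ hσ hK hν hCK hε hεκ hrate
  have ha := modelExponent_pos A c
  have hcard := ncard_le_exp hd hT hd₀ hQ
  change _ ≤ Real.exp (modelExponent A c * d₀ * Real.log (d * T)) at hcard
  set a := modelExponent A c
  have hd' : (1 : ℝ) ≤ d := by exact_mod_cast hd
  have hT' : (2 : ℝ) ≤ T := by exact_mod_cast hT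
  have hd₀' : (1 : ℝ) ≤ d₀ := by exact_mod_cast hd₀
  have hL2 : Real.log 2 ≤ Real.log (d * T) := Real.log_le_log (by norm_num) (by nlinarith)
  have hLT : Real.log T ≤ Real.log (d * T) := Real.log_le_log (by linarith) (by nlinarith)
  have hlog2 : (1 : ℝ) / 2 ≤ Real.log 2 := by linarith [Real.log_two_gt_d9]
  have hdT : (2 : ℝ) ≤ d * T := by nlinarith
  have hTdT : (T : ℝ) ≤ d * T := le_mul_of_one_le_left (by positivity) hd'
  set L := Real.log (d * T) with hLdef
  have hDL : L ≤ d₀ * L := by nlinarith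
  have hDL0 : 0 < d₀ * L := by nlinarith
  have hρ : 1 ≤ K / C := (one_le_div hν).2 hCK
  have ht₂0 : 0 < t₂ := by
    have : (0 : ℝ) < t₂ := lt_of_lt_of_le (by positivity) hb1
    exact_mod_cast this
  obtain ⟨hfin, hMcard⟩ := finite_models_and_ncard_le (Q := Q)
  set P := hfin.toFinset with hP
  have hPcard : (P.card : ℝ) ≤ Real.exp (a * d₀ * L) := by
    refine le_trans ?_ hcard
    rw [hP, ← Set.ncard_eq_toFinset_card (models Q) hfin]
    exact_mod_cast hMcard
  set lev : ℝ := 2 * T * Real.exp (a * d₀ * L) with hlev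
  have hlev0 : 0 < lev := by positivity
  set E₁ : Submodule ℝ (Vec d) → Set Ω := fun m => {ω | ∃ u ∈ m ⊔ fixedSubspace G,
    ∑ t ∈ Finset.range t₂, (inner ℝ (arm t ω) u) ^ 2 < t₂ * C / 32 * ‖u‖ ^ 2} with hE₁
  set E₂ : Submodule ℝ (Vec d) → Set Ω := fun m => {ω | lev ≤
    mixture (m ⊔ fixedSubspace G) (t₂ * C / 32) σ θ arm reward 0 t₂ ω} with hE₂
  -- The constants of `exploreFactor`: 1024 = 16 · 64, and 9 + a = 7 + (2 + a), with 7 from 1 +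
  -- 32K/C ≤ 64T and 2 + a from the level `lev`.
  have hlarge : 16 * σ ^ 2 * (d₀ * Real.log (1 + 32 * K / C) + Real.log lev) ≤
      t₂ * C * ε ^ 2 / 64 := by
    have h1 : Real.log (1 + 32 * K / C) ≤ 7 * L := by
      have h2 : 1 + 32 * K / C ≤ 2 ^ 6 * T := by rw [mul_div_assoc]; linarith
      have h3 := Real.log_le_log (by positivity) h2
      rw [Real.log_mul (by norm_num) (by positivity), Real.log_pow] at h3
      push_cast at h3
      linarith
    have h4 : Real.log lev ≤ (2 + a) * (d₀ * L) := by
      rw [hlev, Real.log_mul (by positivity) (Real.exp_pos _).ne', Real.log_exp,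
        Real.log_mul (by norm_num) (by positivity)]
      linarith
    have h5 : d₀ * Real.log (1 + 32 * K / C) + Real.log lev ≤ (9 + a) * (d₀ * L) := by
      have : d₀ * Real.log (1 + 32 * K / C) ≤ d₀ * (7 * L) := by gcongr
      linarith
    have h6 : 16 * σ ^ 2 * (d₀ * Real.log (1 + 32 * K / C) + Real.log lev) ≤
        16 * σ ^ 2 * ((9 + a) * (d₀ * L)) := by gcongr
    linarith
  have hsub : {ω | θ ∉ mhat ω} ⊆ ⋃ m ∈ P, (E₁ m ∪ E₂ m) := by
    intro ω hω
    by_contra hcon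
    have hsel := hE.mhat_selected ω
    simp only [Set.mem_iUnion, not_exists] at hcon
    have hcon' := hcon (mhat ω) (hfin.mem_toFinset.2 hsel.1)
    simp only [hE₁, hE₂, Set.mem_union, Set.mem_ofPred_eq, not_or, not_exists, not_and,
      not_lt, not_le] at hcon'
    exact hω (mem_of_isSelected hσ hε hν hK0 ht₂0 hθ hG hsep hQ.1 hlev0 hsel
      (fun t ht => (hB _ (hI.arm_mem t (ht.trans_le ht₂) ω)).1 _
        ⟨_, hsel.1, _, hGm, rfl⟩) hcon'.1 hcon'.2 hlarge)
  have hE₁le : ∀ m ∈ P, μ (E₁ m) ≤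
      ENNReal.ofReal (Real.exp (-(a * d₀ * L)) * (1 / (2 * T))) := by
    intro m hm
    have hm' : m ∈ models Q := hfin.mem_toFinset.1 hm
    -- With N = 8dT, d/N² = 1/(64dT²) ≤ C/(64K) because K/C ≤ T. The net has at most (16dT +
    -- 1)^(2d₀) ≤ exp(12 d₀ L) points; in 14 = 12 + 2 below, the 2 pays for the factor 1/(2T).
    have hN : 0 < 8 * (d * T) := by positivity
    refine (measure_exists_sum_inner_sq_lt_le hI hE ht₂ hdist hν hK0 hCK
      (fun x hx => (hB x hx).1 _ ⟨_, hm', _, hGm, rfl⟩)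
      (finrank_sup_le_of_mem_models hQ.1 hm' hGm) hN ?_).trans (ENNReal.ofReal_le_ofReal ?_)
    · have h1 : (d : ℝ) / ((8 * (d * T) : ℕ) : ℝ) ^ 2 = 1 / (64 * (d * T) * T) := by
        push_cast; field_simp; norm_num
      have h2 : C / (64 * K) = 1 / (64 * (K / C)) := by field_simp
      rw [← hC, h1, h2]
      apply one_div_le_one_div_of_le (by positivity)
      have : (T : ℝ) ≤ d * T * T := by
        rw [mul_assoc]
        exact (le_mul_of_one_le_left (by positivity) (by linarith)).trans
          (le_mul_of_one_le_left (by positivity) hd')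
      linarith
    · rw [← hC]
      have h1 : (2 * ((8 * (d * T) : ℕ) : ℝ) + 1) ≤ Real.exp (6 * L) := by
        push_cast
        exact two_mul_eight_mul_add_one_le hdT
      have h4 : (2 * ((8 * (d * T) : ℕ) : ℝ) + 1) ^ (2 * d₀) ≤ Real.exp (12 * (d₀ * L)) := by
        refine (pow_le_pow_left₀ (by positivity) h1 _).trans (le_of_eq ?_)
        rw [← Real.exp_nat_mul]
        congr 1; push_cast; ring
      have h5 : (14 + a) * (d₀ * L) ≤ t₂ * C / (4 * K) := by
        have h6 : 1024 * (9 + a) * (d₀ * L) ≤ t₂ * C / K := by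
          rw [le_div_iff₀ hK0]
          have := mul_le_mul_of_nonneg_right hb1 hν.le
          refine le_trans (le_of_eq ?_) this
          field_simp
        have h7 : t₂ * C / (4 * K) = t₂ * C / K / 4 := by field_simp
        rw [h7]
        nlinarith
      calc (2 * ((8 * (d * T) : ℕ) : ℝ) + 1) ^ (2 * d₀) * Real.exp (-(t₂ * C / (4 * K)))
          ≤ Real.exp (12 * (d₀ * L)) * Real.exp (-((14 + a) * (d₀ * L))) := by gcongr
        _ ≤ Real.exp (-(a * d₀ * L)) * Real.exp (-(2 * L)) := by
            rw [← Real.exp_add, ← Real.exp_add]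
            apply Real.exp_le_exp.2
            linarith
        _ ≤ Real.exp (-(a * d₀ * L)) * (1 / (2 * T)) := by
            gcongr
            exact exp_neg_two_mul_log_le (by positivity) hdT hTdT

  have hE₂le : ∀ m ∈ P, μ (E₂ m) ≤
      ENNReal.ofReal (Real.exp (-(a * d₀ * L)) * (1 / (2 * T))) := by
    intro m _
    have hlam : 0 < t₂ * C / 32 := by positivity
    have h1 := hI.measure_mixture_ge_le (m ⊔ fixedSubspace G) hlam hσ (Nat.zero_le t₂) ht₂ hlev0
      MeasurableSet.univ
    rw [measure_univ, mul_one, Set.univ_inter] at h1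
    refine (measure_mono fun ω hω => ?_).trans (h1.trans (ENNReal.ofReal_le_ofReal ?_))
    · exact ⟨t₂, Nat.zero_le _, le_rfl, hω⟩
    · rw [hlev, mul_inv, Real.exp_neg, one_div, mul_comm]
  calc μ {ω | θ ∉ mhat ω} ≤ ∑ m ∈ P, μ (E₁ m ∪ E₂ m) :=
        (measure_mono hsub).trans (measure_biUnion_finset_le _ _)
    _ ≤ ∑ m ∈ P, ENNReal.ofReal (Real.exp (-(a * d₀ * L)) * (1 / T)) := by
        refine Finset.sum_le_sum fun m hm => (measure_union_le _ _).trans ?_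
        refine (add_le_add (hE₁le m hm) (hE₂le m hm)).trans (le_of_eq ?_)
        rw [← ENNReal.ofReal_add (by positivity) (by positivity)]
        congr 1; field_simp; norm_num
    _ = ENNReal.ofReal (P.card * (Real.exp (-(a * d₀ * L)) * (1 / T))) := by
        rw [Finset.sum_const, nsmul_eq_mul, ← ENNReal.ofReal_natCast,
          ← ENNReal.ofReal_mul (Nat.cast_nonneg _)]
    _ ≤ ENNReal.ofReal (1 / T) := by
        refine ENNReal.ofReal_le_ofReal ?_
        calc P.card * (Real.exp (-(a * d₀ * L)) * (1 / T))
            ≤ Real.exp (a * d₀ * L) * (Real.exp (-(a * d₀ * L)) * (1 / T)) := by gcongr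
          _ = 1 / T := by rw [← mul_assoc, ← Real.exp_add]; simp

end Selection

/-! ### Confidence ellipsoids, optimism and the elliptical potential. -/

section OFUL
variable {d : ℕ} {Ω : Type*} {m : Submodule ℝ (Vec d)} {lam σ S : ℝ} {θ : Vec d} {a t T : ℕ}
  {arm : ℕ → Ω → Vec d} {reward : ℕ → Ω → ℝ} {ω : Ω}

/-- The normal equations: since θ ∈ m, rewards are linear in the projected arms up to noise, and
only the ridge bias λθ and the noise sum survive. -/
theorem gram_mulVec_sub_ridge (hlam : 0 < lam) (hθ : θ ∈ m) :
    gram m lam (Finset.Ico a t) (fun s => arm s ω) *ᵥ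
      (θ - ridge m lam (Finset.Ico a t) (fun s => arm s ω) fun s => reward s ω).ofLp =
        lam • θ.ofLp + -noiseSum m θ arm reward a t ω := by
  have hV := gram_posDef m (Finset.Ico a t) (fun s => arm s ω) hlam
  rw [WithLp.ofLp_sub, mulVec_sub, ridge]
  simp only
  rw [mulVec_inv_mulVec hV, gram, add_mulVec, smul_mulVec, one_mulVec, sum_mulVec, noiseSum,
    add_sub_assoc, ← Finset.sum_sub_distrib, ← Finset.sum_neg_distrib]
  congr 1
  refine Finset.sum_congr rfl fun s _ => ?_
  rw [vecMulVec_mulVec_eq, dotProduct_eq_inner, inner_starProjection_of_mem hθ, noise, ← sub_smul,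
    ← neg_smul]
  congr 1
  ring

/-- The confidence ellipsoid contains the parameter as long as the mixture is small. -/
theorem mem_confSet_of_mixture_lt (hlam : 0 < lam) (hσ : 0 < σ) (hT : 0 < T) (hθ : θ ∈ m)
    (hS : ‖θ‖ ≤ S) (h : mixture m lam σ θ arm reward a t ω < T) :
    θ ∈ confSet m σ lam S (1 / (T : ℝ)) (Finset.Ico a t) (fun s => arm s ω)
      (fun s => reward s ω) := by
  refine ⟨hθ, ?_⟩
  have hT' : (0 : ℝ) < T := by exact_mod_cast hT
  have hV := gram_posDef m (Finset.Ico a t) (fun s => arm s ω) hlam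
  have hg := gram_mulVec_sub_ridge (reward := reward) (arm := arm) (a := a) (t := t) (ω := ω)
    hlam hθ
  have hq := quadForm_lt_of_mixture_lt hlam hσ hT' h
  set V := gram m lam (Finset.Ico a t) (fun s => arm s ω) with hVdef
  set e := (θ - ridge m lam (Finset.Ico a t) (fun s => arm s ω) fun s => reward s ω).ofLp
  set N := noiseSum m θ arm reward a t ω
  -- The V-norm of the error is the V⁻¹-norm of λθ - N. The triangle inequality separates the bias,
  -- at most √λ S, from the noise, which the mixture controls.
  have h1 : e ⬝ᵥ (V *ᵥ e) = (lam • θ.ofLp + -N) ⬝ᵥ (V⁻¹ *ᵥ (lam • θ.ofLp + -N)) := by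
    rw [← hg, inv_mulVec_mulVec hV, dotProduct_comm]
  have h2 : √((lam • θ.ofLp) ⬝ᵥ (V⁻¹ *ᵥ (lam • θ.ofLp))) ≤ √lam * S := by
    have h3 := quadForm_inv_le hV hlam (gram_quadForm_ge m (Finset.Ico a t) fun s => arm s ω) θ.ofLp
    rw [dotProduct_self_eq] at h3
    rw [Real.sqrt_le_left (by positivity [(norm_nonneg θ).trans hS]), mul_pow, Real.sq_sqrt hlam.le,
      mulVec_smul, dotProduct_smul, smul_dotProduct, smul_eq_mul, smul_eq_mul]
    calc lam * (lam * (θ.ofLp ⬝ᵥ (V⁻¹ *ᵥ θ.ofLp))) ≤ lam * (lam * (‖θ‖ ^ 2 / lam)) := by gcongr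
      _ = lam * ‖θ‖ ^ 2 := by field_simp
      _ ≤ lam * S ^ 2 := by gcongr
  have h4 : √((-N) ⬝ᵥ (V⁻¹ *ᵥ (-N))) ≤
      σ * √(2 * Real.log (√(V.det / lam ^ d) / (1 / (T : ℝ)))) := by
    rw [mulVec_neg, neg_dotProduct_neg, Real.sqrt_le_left (by positivity), mul_pow, Real.sq_sqrt]
    · rw [div_div_eq_mul_div, div_one]
      linarith
    · rw [div_div_eq_mul_div, div_one]
      -- The logarithm under the root is nonnegative because it dominates a nonnegative quadratic
      -- form.
      have h5 := (quadForm_nonneg hV.inv.posSemidef N).trans_lt hq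
      have h6 : 0 < σ ^ 2 := by positivity
      by_contra hcon
      push Not at hcon
      nlinarith
  rw [h1, confRadius]
  refine (sqrt_quadForm_add_le hV.inv.posSemidef _ _).trans ?_
  linarith

/-- The regret of one round of OFUL. -/
theorem inner_sub_le_of_oful {X : Set (Vec d)} {xstar : Vec d} (hlam : 0 < lam) (hx : xstar ∈ X)
    {δ : ℝ} (hθ : θ ∈ confSet m σ lam S δ (Finset.Ico a t) (fun s => arm s ω) fun s => reward s ω)
    (hplay : ∃ θ' ∈ confSet m σ lam S δ (Finset.Ico a t) (fun s => arm s ω) (fun s => reward s ω),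
      ∀ x ∈ X, ∀ θ'' ∈ confSet m σ lam S δ (Finset.Ico a t) (fun s => arm s ω)
          (fun s => reward s ω), inner ℝ x θ'' ≤ inner ℝ (arm t ω) θ') :
    inner ℝ (xstar - arm t ω) θ ≤
      2 * confRadius m σ lam S δ (Finset.Ico a t) (fun s => arm s ω) *
        √((m.starProjection (arm t ω)).ofLp ⬝ᵥ
          ((gram m lam (Finset.Ico a t) fun s => arm s ω)⁻¹ *ᵥ
            (m.starProjection (arm t ω)).ofLp)) := by
  obtain ⟨θ', hθ', hmax⟩ := hplay
  have hV := gram_posDef m (Finset.Ico a t) (fun s => arm s ω) hlam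
  -- Optimism: the regret is at most ⟨z, θ' - θ⟩, and θ and θ' both lie within β of the ridge
  -- estimate r.
  have h1 := hmax xstar hx θ hθ
  set V := gram m lam (Finset.Ico a t) (fun s => arm s ω)
  set z := m.starProjection (arm t ω)
  set r := ridge m lam (Finset.Ico a t) (fun s => arm s ω) (fun s => reward s ω)
  set β := confRadius m σ lam S δ (Finset.Ico a t) (fun s => arm s ω)
  have h2 := dotProduct_le_sqrt_mul_sqrt hV z.ofLp (θ' - r).ofLp
  have h3 := dotProduct_le_sqrt_mul_sqrt hV z.ofLp (-(θ - r).ofLp)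
  rw [mulVec_neg, neg_dotProduct_neg, dotProduct_neg] at h3
  rw [dotProduct_eq_inner, inner_sub_right] at h2 h3
  have h4 := inner_starProjection_of_mem hθ'.1 (arm t ω)
  have h5 := inner_starProjection_of_mem hθ.1 (arm t ω)
  have h6 := mul_le_mul_of_nonneg_left hθ'.2 (Real.sqrt_nonneg (z.ofLp ⬝ᵥ (V⁻¹ *ᵥ z.ofLp)))
  have h7 := mul_le_mul_of_nonneg_left hθ.2 (Real.sqrt_nonneg (z.ofLp ⬝ᵥ (V⁻¹ *ᵥ z.ofLp)))
  rw [inner_sub_left]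
  linarith

/-- The elliptical potential: the logarithm of the determinant sums up the squared norms. -/
theorem sum_log_one_add_eq (hlam : 0 < lam) (x : ℕ → Vec d) (h : a ≤ t) :
    ∑ s ∈ Finset.Ico a t, Real.log (1 + (m.starProjection (x s)).ofLp ⬝ᵥ
        ((gram m lam (Finset.Ico a s) x)⁻¹ *ᵥ (m.starProjection (x s)).ofLp)) =
      Real.log ((gram m lam (Finset.Ico a t) x).det / lam ^ d) := by
  induction t, h using Nat.le_induction with
  | base =>
    have : lam ^ d ≠ 0 := by positivity
    simp [this]
  | succ t h ih =>
    have hV := gram_posDef m (Finset.Ico a t) x hlam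
    have hdet : 0 < (gram m lam (Finset.Ico a t) x).det / lam ^ d :=
      div_pos hV.det_pos (by positivity)
    have hw := quadForm_nonneg hV.inv.posSemidef (m.starProjection (x t)).ofLp
    rw [Finset.sum_Ico_succ_top h, ih, gram_Ico_succ m x h, det_add_vecMulVec hV,
      mul_div_right_comm, Real.log_mul hdet.ne' (by positivity)]

/-- For w ≥ τ the trivial bound 2R is charged to log(1 + w)/log(1 + τ) ≥ 1. For w ≤ τ, log(1 + w) ≥
w/(1 + w) gives w ≤ (1 + τ) log(1 + w). Both terms are then summable through the potential. -/
theorem le_log_add_sqrt_log {R β τ w ρ : ℝ} (hR : 0 ≤ R) (hβ : 0 ≤ β) (hτ : 0 < τ) (hw : 0 ≤ w)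
    (h1 : ρ ≤ 2 * R) (h2 : ρ ≤ 2 * β * √w) :
    ρ ≤ 2 * R / Real.log (1 + τ) * Real.log (1 + w) +
      2 * β * √(1 + τ) * √(Real.log (1 + w)) := by
  have hℓ : 0 < Real.log (1 + τ) := Real.log_pos (by linarith)
  have hw' : 0 ≤ Real.log (1 + w) := Real.log_nonneg (by linarith)
  rcases le_total τ w with h | h
  · have h3 : Real.log (1 + τ) ≤ Real.log (1 + w) := Real.log_le_log (by linarith) (by linarith)
    have h4 : 2 * R ≤ 2 * R / Real.log (1 + τ) * Real.log (1 + w) := by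
      rw [div_mul_eq_mul_div, le_div_iff₀ hℓ]
      gcongr
    have : 0 ≤ 2 * β * √(1 + τ) * √(Real.log (1 + w)) := by positivity
    linarith
  · have h3 : w ≤ (1 + τ) * Real.log (1 + w) := by
      have h4 := Real.one_sub_inv_le_log_of_pos (by linarith : 0 < 1 + w)
      have h5 : 1 - (1 + w)⁻¹ = w / (1 + w) := by field_simp; ring
      rw [h5, div_le_iff₀ (by linarith)] at h4
      calc w ≤ Real.log (1 + w) * (1 + w) := h4
        _ ≤ Real.log (1 + w) * (1 + τ) := by gcongr
        _ = _ := mul_comm _ _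
    have h6 : √w ≤ √(1 + τ) * √(Real.log (1 + w)) := by
      rw [← Real.sqrt_mul (by linarith)]
      exact Real.sqrt_le_sqrt h3
    have h7 : 2 * β * √w ≤ 2 * β * (√(1 + τ) * √(Real.log (1 + w))) := by gcongr
    have h8 : 0 ≤ 2 * R / Real.log (1 + τ) * Real.log (1 + w) := by positivity
    linarith

theorem sum_sqrt_le {ι : Type*} (I : Finset ι) {f : ι → ℝ} (hf : ∀ i ∈ I, 0 ≤ f i) {n B : ℝ}
    (hI : (I.card : ℝ) ≤ n) (hB : ∑ i ∈ I, f i ≤ B) : ∑ i ∈ I, √(f i) ≤ √(n * B) := by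
  refine Real.le_sqrt_of_sq_le (sq_sum_le_card_mul_sum_sq.trans ?_)
  rw [Finset.sum_congr rfl fun i hi => Real.sq_sqrt (hf i hi)]
  have h0 : 0 ≤ ∑ i ∈ I, f i := Finset.sum_nonneg hf
  have hn : 0 ≤ n := (Nat.cast_nonneg _).trans hI
  gcongr

/-- The regret of OFUL on a correct model, on the event that the mixture stays small. -/
theorem sum_regret_le_of_oful {X : Set (Vec d)} {xstar : Vec d} {K R τ : ℝ} {d₀ : ℕ}
    (hlam : 0 < lam) (hσ : 0 < σ) (hT : 0 < T) (hR : 0 ≤ R) (hK : 0 ≤ K) (hτ : 0 < τ) (haT : a ≤ T)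
    (hS : ‖θ‖ ≤ S) (hθ : θ ∈ m) (hx : xstar ∈ X) (hm : Module.finrank ℝ m ≤ d₀)
    (hXK : ∀ t < T, ‖m.starProjection (arm t ω)‖ ^ 2 ≤ K)
    (hXR : ∀ t < T, inner ℝ (xstar - arm t ω) θ ≤ 2 * R)
    (hmix : ∀ t, a ≤ t → t ≤ T → mixture m lam σ θ arm reward a t ω < T)
    (hplay : ∀ t, a ≤ t → t < T →
      ∃ θ' ∈ confSet m σ lam S (1 / (T : ℝ)) (Finset.Ico a t) (fun s => arm s ω)
        (fun s => reward s ω),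
      ∀ x ∈ X, ∀ θ'' ∈ confSet m σ lam S (1 / (T : ℝ)) (Finset.Ico a t) (fun s => arm s ω)
          (fun s => reward s ω), inner ℝ x θ'' ≤ inner ℝ (arm t ω) θ') :
    ∑ t ∈ Finset.Ico a T, inner ℝ (xstar - arm t ω) θ ≤
      2 * R / Real.log (1 + τ) * (d₀ * Real.log (1 + T * K / lam)) +
      2 * (σ * √(d₀ * Real.log (1 + T * K / lam) + 2 * Real.log T) + √lam * S) * √(1 + τ) *
        √(T * (d₀ * Real.log (1 + T * K / lam))) := by
  have hT' : (0 : ℝ) < T := by exact_mod_cast hT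
  set Λ := d₀ * Real.log (1 + T * K / lam) with hΛ
  set β := σ * √(Λ + 2 * Real.log T) + √lam * S with hβ
  have hS0 : 0 ≤ S := (norm_nonneg θ).trans hS
  have hβ0 : 0 ≤ β := by positivity
  have hℓ : 0 < Real.log (1 + τ) := Real.log_pos (by linarith)
  have hlogdet : ∀ t, t ≤ T →
      Real.log ((gram m lam (Finset.Ico a t) fun s => arm s ω).det / lam ^ d) ≤ Λ := by
    intro t ht
    have hdet : 0 < (gram m lam (Finset.Ico a t) fun s => arm s ω).det / lam ^ d :=
      div_pos (gram_det_pos m _ _ hlam) (by positivity)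
    have h1 := Real.log_le_log hdet (gram_det_div_le m (Finset.Ico a t) (fun s => arm s ω) hlam hm
      hK (n := T) (by rw [Nat.card_Ico]; omega)
      fun s hs => hXK s ((Finset.mem_Ico.1 hs).2.trans_le ht))
    rwa [Real.log_pow] at h1
  set w : ℕ → ℝ := fun t => (m.starProjection (arm t ω)).ofLp ⬝ᵥ
    ((gram m lam (Finset.Ico a t) fun s => arm s ω)⁻¹ *ᵥ (m.starProjection (arm t ω)).ofLp) with hw
  have hw0 : ∀ t, 0 ≤ w t := fun t => quadForm_nonneg
    (gram_posDef m (Finset.Ico a t) (fun s => arm s ω) hlam).inv.posSemidef _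
  have hround : ∀ t ∈ Finset.Ico a T, inner ℝ (xstar - arm t ω) θ ≤
      2 * R / Real.log (1 + τ) * Real.log (1 + w t) +
        2 * β * √(1 + τ) * √(Real.log (1 + w t)) := by
    intro t ht
    rw [Finset.mem_Ico] at ht
    refine le_log_add_sqrt_log hR hβ0 hτ (hw0 t) (hXR t ht.2) ?_
    refine (inner_sub_le_of_oful hlam hx (mem_confSet_of_mixture_lt hlam hσ hT hθ hS
      (hmix t ht.1 ht.2.le)) (hplay t ht.1 ht.2)).trans ?_
    have hdet : 0 < (gram m lam (Finset.Ico a t) fun s => arm s ω).det / lam ^ d :=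
      div_pos (gram_det_pos m _ _ hlam) (by positivity)
    have hrad : confRadius m σ lam S (1 / (T : ℝ)) (Finset.Ico a t) (fun s => arm s ω) ≤ β := by
      rw [confRadius, hβ, div_div_eq_mul_div, div_one, Real.log_mul (Real.sqrt_pos.2 hdet).ne'
        hT'.ne', Real.log_sqrt hdet.le]
      gcongr
      linarith [hlogdet t ht.2.le]
    gcongr
  have hsum : ∑ t ∈ Finset.Ico a T, Real.log (1 + w t) ≤ Λ :=
    (sum_log_one_add_eq hlam (fun s => arm s ω) haT).le.trans (hlogdet T le_rfl)
  have hsqrt := sum_sqrt_le (Finset.Ico a T) (f := fun t => Real.log (1 + w t))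
    (fun t _ => Real.log_nonneg (by linarith [hw0 t])) (n := T)
    (by rw [Nat.card_Ico]; exact_mod_cast Nat.sub_le T a) hsum
  refine (Finset.sum_le_sum hround).trans ?_
  rw [Finset.sum_add_distrib, ← Finset.mul_sum, ← Finset.mul_sum]
  gcongr

end OFUL

/-! ### The final form of the OFUL bound, and passage to the expectation. -/

/-- The factor in front of the regret of OFUL. -/
def ofulFactor (κ : ℝ) : ℝ := 4 * (2 * |κ| + 6) + 8 + 8 * (1 + |κ|) * (2 * |κ| + 12)

theorem ofulFactor_pos (κ : ℝ) : 0 < ofulFactor κ := by unfold ofulFactor; positivity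

/-- The tuning gives K/λ ≤ κ(K/C)(R/σ)². With K/C ≤ T and R/σ ≤ T²τ the argument is at most (1 +
κ)T⁶τ², and log(1 + κ) ≤ κ ≤ 2κ log T. -/
theorem log_potential_le {κ K C R σ lam T τ : ℝ} (hκ : 0 < κ) (hC : 0 < C) (hK : 0 < K)
    (hσ : 0 < σ) (hlam : 0 < lam) (hT : 2 ≤ T) (hρ : K / C ≤ T) (hτ : 1 ≤ τ) (hR : 0 < R)
    (hRτ : R / σ ≤ T ^ 2 * τ) (hlamR : σ ^ 2 * C ≤ κ * lam * R ^ 2) :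
    Real.log (1 + T * K / lam) ≤ (2 * κ + 6) * Real.log T + 2 * Real.log τ := by
  have hlog2 : (1 : ℝ) / 2 ≤ Real.log 2 := by linarith [Real.log_two_gt_d9]
  have hLT : Real.log 2 ≤ Real.log T := Real.log_le_log (by norm_num) hT
  have h1 : K / lam ≤ κ * (K / C) * (R / σ) ^ 2 := by
    rw [div_le_iff₀ hlam]
    calc K = (K / C / σ ^ 2) * (σ ^ 2 * C) := by field_simp
      _ ≤ (K / C / σ ^ 2) * (κ * lam * R ^ 2) := by gcongr
      _ = _ := by field_simp
  have h2 : T * K / lam ≤ κ * (T ^ 6 * τ ^ 2) := by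
    calc T * K / lam = T * (K / lam) := by ring
      _ ≤ T * (κ * (K / C) * (R / σ) ^ 2) := by gcongr
      _ ≤ T * (κ * T * (T ^ 2 * τ) ^ 2) := by gcongr
      _ = _ := by ring
  have h3 : 1 ≤ T ^ 6 * τ ^ 2 :=
    one_le_mul_of_one_le_of_one_le (one_le_pow₀ (by linarith)) (one_le_pow₀ hτ)
  have h4 : 1 + T * K / lam ≤ (1 + κ) * (T ^ 6 * τ ^ 2) := by linarith
  have h5 := Real.log_le_log (by positivity) h4
  rw [Real.log_mul (by positivity) (by positivity), Real.log_mul (by positivity) (by positivity),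
    Real.log_pow, Real.log_pow] at h5
  have h6 : Real.log (1 + κ) ≤ κ := by
    have := Real.log_le_sub_one_of_pos (by linarith : 0 < 1 + κ)
    linarith
  push_cast at h5
  nlinarith

/-- This is the cost of the rounds with w ≥ τ: the denominator log(1 + τ) cancels the log τ of the
potential. -/
theorem count_term_le {g R D ℓ τ Λ : ℝ} (hg : 0 < g) (hℓ : 1 / 2 ≤ ℓ) (hR : 0 < R) (hD : 1 ≤ D)
    (hτ : 1 ≤ τ) (hΛ : Λ ≤ D * (g * ℓ + 2 * Real.log τ)) :
    2 * R / Real.log (1 + τ) * Λ ≤ (4 * g + 8) * (R * (D * ℓ)) := by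
  have hℓ2 : 1 / 2 ≤ Real.log (1 + τ) := by
    have := Real.log_le_log (by norm_num) (by linarith : (2 : ℝ) ≤ 1 + τ)
    linarith [Real.log_two_gt_d9]
  have hℓτ : Real.log τ ≤ Real.log (1 + τ) := Real.log_le_log (by linarith) (by linarith)
  rw [div_mul_eq_mul_div, div_le_iff₀ (by linarith)]
  have h2 : g * ℓ ≤ 2 * (g * ℓ) * Real.log (1 + τ) := by
    have : 0 < g * ℓ := by positivity
    nlinarith
  have h3 : 2 * Real.log τ ≤ 4 * ℓ * Real.log (1 + τ) := by nlinarith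
  have h1 : g * ℓ + 2 * Real.log τ ≤ (2 * g + 4) * ℓ * Real.log (1 + τ) := by linarith
  calc 2 * R * Λ ≤ 2 * R * (D * ((2 * g + 4) * ℓ * Real.log (1 + τ))) :=
        mul_le_mul_of_nonneg_left (hΛ.trans (mul_le_mul_of_nonneg_left h1 (by linarith)))
          (by linarith)
    _ = _ := by ring

/-- This is the cost of the rounds with w ≤ τ. One √Λ comes from the radius and one from
Cauchy-Schwarz over the rounds, so the dimension enters linearly. -/
theorem radius_term_le {g κ σ b D ℓ T τ Λ : ℝ} (hκ : 0 < κ) (hσ : 0 < σ)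
    (hb : b ≤ κ * σ) (hℓ : 1 / 2 ≤ ℓ) (hD : 1 ≤ D) (hT : 0 ≤ T) (hτ : 1 ≤ τ) (hΛ0 : 0 ≤ Λ)
    (hΛ : Λ ≤ D * (g * ℓ + 2 * Real.log τ)) :
    2 * (σ * √(Λ + 2 * ℓ) + b) * √(1 + τ) * √(T * Λ) ≤
      4 * (1 + κ) * (σ * D * ((√T * √τ) * ((g + 2) * ℓ + 2 * Real.log τ))) := by
  have h1 : √(Λ + 2 * ℓ) * √Λ ≤ Λ + 2 * ℓ := by
    calc √(Λ + 2 * ℓ) * √Λ ≤ √(Λ + 2 * ℓ) * √(Λ + 2 * ℓ) :=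
          mul_le_mul_of_nonneg_left (Real.sqrt_le_sqrt (by linarith)) (Real.sqrt_nonneg _)
      _ = _ := Real.mul_self_sqrt (by linarith)
  have h2 : √Λ ≤ Λ + 2 * ℓ := by
    rw [Real.sqrt_le_left (by linarith)]
    nlinarith
  have h3 : Λ + 2 * ℓ ≤ D * ((g + 2) * ℓ + 2 * Real.log τ) := by nlinarith
  have hβ : (σ * √(Λ + 2 * ℓ) + b) * √Λ ≤
      σ * ((1 + κ) * (D * ((g + 2) * ℓ + 2 * Real.log τ))) := by
    calc (σ * √(Λ + 2 * ℓ) + b) * √Λ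
        ≤ (σ * √(Λ + 2 * ℓ) + κ * σ) * √Λ :=
          mul_le_mul_of_nonneg_right (by linarith) (Real.sqrt_nonneg _)
      _ = σ * (√(Λ + 2 * ℓ) * √Λ + κ * √Λ) := by ring
      _ ≤ σ * ((Λ + 2 * ℓ) + κ * (Λ + 2 * ℓ)) :=
          mul_le_mul_of_nonneg_left (add_le_add h1 (mul_le_mul_of_nonneg_left h2 hκ.le)) hσ.le
      _ = σ * ((1 + κ) * (Λ + 2 * ℓ)) := by ring
      _ ≤ _ := by gcongr
  have h4 : √(1 + τ) ≤ 2 * √τ := by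
    rw [Real.sqrt_le_left (by positivity), mul_pow, Real.sq_sqrt (by linarith)]
    linarith
  have h5 : 0 ≤ σ * ((1 + κ) * (D * ((g + 2) * ℓ + 2 * Real.log τ))) := by
    have : 0 ≤ D * ((g + 2) * ℓ + 2 * Real.log τ) := by linarith
    positivity
  rw [Real.sqrt_mul hT]
  calc 2 * (σ * √(Λ + 2 * ℓ) + b) * √(1 + τ) * (√T * √Λ)
      = 2 * ((σ * √(Λ + 2 * ℓ) + b) * √Λ) * (√(1 + τ) * √T) := by ring
    _ ≤ 2 * (σ * ((1 + κ) * (D * ((g + 2) * ℓ + 2 * Real.log τ)))) * (2 * √τ * √T) :=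
        mul_le_mul (by linarith) (mul_le_mul_of_nonneg_right h4 (Real.sqrt_nonneg _))
          (by positivity) (by linarith)
    _ = _ := by ring

/-- If the maximum is 1, this is the target rate. Otherwise σT²τ = R, and √T, log T ≤ T together
with log τ ≤ 2√τ bound the term by a multiple of σDT²τ = RD. -/
theorem scaled_term_le {g R σ D T : ℝ} (hg : 0 < g) (hσ : 0 < σ) (hT : 2 ≤ T) (hR : 0 < R)
    (hD : 1 ≤ D) (hlog : 1 / 2 ≤ Real.log T) :
    σ * D * ((√T * √(max 1 (R / σ / T ^ 2))) *
        ((g + 2) * Real.log T + 2 * Real.log (max 1 (R / σ / T ^ 2)))) ≤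
      (g + 2) * (σ * D * √T * Real.log T) + 2 * (g + 6) * (R * (D * Real.log T)) := by
  have hT0 : 0 < T := by linarith
  rcases le_total (R / σ / T ^ 2) 1 with h | h
  · rw [max_eq_left h, Real.log_one, Real.sqrt_one]
    have : 0 ≤ 2 * (g + 6) * (R * (D * Real.log T)) := by positivity
    linarith
  · rw [max_eq_right h]
    have hτ1 : T ^ 2 * (R / σ / T ^ 2) = R / σ := by field_simp
    generalize R / σ / T ^ 2 = τ at h hτ1
    have hsT : √T ≤ T := by rw [Real.sqrt_le_left hT0.le]; nlinarith
    have hsτ1 : 1 ≤ √τ := Real.one_le_sqrt.2 h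
    have hττ : √τ * √τ = τ := Real.mul_self_sqrt (by linarith)
    have hlT : Real.log T ≤ T := by linarith [Real.log_le_sub_one_of_pos hT0]
    have hlτ : Real.log τ ≤ 2 * √τ := by
      have h1 := Real.log_le_sub_one_of_pos (by linarith : 0 < √τ)
      rw [Real.log_sqrt (by linarith)] at h1
      linarith
    have hx : T ≤ T * √τ := le_mul_of_one_le_right hT0.le hsτ1
    have hy : √τ ≤ T * √τ := le_mul_of_one_le_left (by linarith) (by linarith)
    have hlog0 : 0 ≤ Real.log τ := Real.log_nonneg h
    have h2 : (√T * √τ) * ((g + 2) * Real.log T + 2 * Real.log τ) ≤ (g + 6) * (T ^ 2 * τ) := by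
      calc (√T * √τ) * ((g + 2) * Real.log T + 2 * Real.log τ)
          ≤ (T * √τ) * ((g + 6) * (T * √τ)) := by
            refine mul_le_mul (mul_le_mul_of_nonneg_right hsT (by linarith)) ?_ (by positivity)
              (by positivity)
            have : (g + 2) * Real.log T ≤ (g + 2) * (T * √τ) :=
              mul_le_mul_of_nonneg_left (hlT.trans hx) (by linarith)
            linarith
        _ = (g + 6) * (T ^ 2 * (√τ * √τ)) := by ring
        _ = _ := by rw [hττ]
    have h3 : 0 ≤ (g + 2) * (σ * D * √T * Real.log T) := by positivity
    have h4 : R * D ≤ R * (D * (2 * Real.log T)) := by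
      refine mul_le_mul_of_nonneg_left ?_ hR.le
      exact le_mul_of_one_le_right (by linarith) (by linarith)
    calc σ * D * ((√T * √τ) * ((g + 2) * Real.log T + 2 * Real.log τ))
        ≤ σ * D * ((g + 6) * (T ^ 2 * τ)) := mul_le_mul_of_nonneg_left h2 (by positivity)
      _ = (g + 6) * (R * D) := by rw [hτ1]; field_simp
      _ ≤ (g + 6) * (R * (D * (2 * Real.log T))) := mul_le_mul_of_nonneg_left h4 (by linarith)
      _ ≤ _ := by linarith

theorem oful_bound_le {κ K C R σ lam S T D : ℝ} (hκ : 0 < κ) (hC : 0 < C) (hK : 0 < K)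
    (hσ : 0 < σ) (hlam : 0 < lam) (hT : 2 ≤ T) (hρ : K / C ≤ T) (hR : 0 < R) (hD : 1 ≤ D)
    (hlamS : √lam * S ≤ κ * σ) (hlamR : σ ^ 2 * C ≤ κ * lam * R ^ 2) :
    2 * R / Real.log (1 + max 1 (R / σ / T ^ 2)) * (D * Real.log (1 + T * K / lam)) +
      2 * (σ * √(D * Real.log (1 + T * K / lam) + 2 * Real.log T) + √lam * S) *
        √(1 + max 1 (R / σ / T ^ 2)) * √(T * (D * Real.log (1 + T * K / lam))) ≤
      ofulFactor κ * (R * (D * Real.log T) + σ * D * √T * Real.log T) := by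
  have hT0 : 0 < T := by linarith
  have hτ : 1 ≤ max 1 (R / σ / T ^ 2) := le_max_left _ _
  have hRτ : R / σ ≤ T ^ 2 * max 1 (R / σ / T ^ 2) := by
    have h := le_max_right 1 (R / σ / T ^ 2)
    rwa [div_le_iff₀ (by positivity), mul_comm] at h
  have hℓ : 1 / 2 ≤ Real.log T := by
    have := Real.log_le_log (by norm_num) hT
    linarith [Real.log_two_gt_d9]
  have hpot0 : 0 ≤ Real.log (1 + T * K / lam) := by
    apply Real.log_nonneg
    have : 0 < T * K / lam := by positivity
    linarith
  have hD0 : 0 ≤ D := by linarith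
  have hΛ0 : 0 ≤ D * Real.log (1 + T * K / lam) := mul_nonneg hD0 hpot0
  have hΛ := mul_le_mul_of_nonneg_left
    (log_potential_le hκ hC hK hσ hlam hT hρ hτ hR hRτ hlamR) hD0
  have hg : 0 < 2 * κ + 6 := by positivity
  have hfirst := count_term_le hg hℓ hR hD hτ hΛ
  have hsecond := radius_term_le hκ hσ hlamS hℓ hD hT0.le hτ hΛ0 hΛ
  have hcase := mul_le_mul_of_nonneg_left (scaled_term_le hg hσ hT hR hD hℓ)
    (by linarith : 0 ≤ 4 * (1 + κ))
  have hx : 0 ≤ (4 * (2 * κ + 6) + 8 + 4 * (1 + κ) * (2 * κ + 16)) *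
      (σ * D * √T * Real.log T) := by positivity
  rw [ofulFactor, abs_of_pos hκ]
  linarith

/-- The exceptional set is replaced by its measurable hull, so it need not be measurable itself. -/
theorem integral_le_of_le_off {Ω : Type*} {mΩ : MeasurableSpace Ω} {μ : Measure Ω}
    [IsProbabilityMeasure μ] {f : Ω → ℝ} (hf : Integrable f μ) {s : Set Ω} {c M p : ℝ}
    (hM : 0 ≤ M) (hle : ∀ ω ∉ s, f ω ≤ c) (hbd : ∀ ω, f ω ≤ c + M) (hs : μ s ≤ ENNReal.ofReal p)
    (hp : 0 ≤ p) : ∫ ω, f ω ∂μ ≤ c + M * p := by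
  set s' := toMeasurable μ s
  have hs' : MeasurableSet s' := measurableSet_toMeasurable _ _
  have hint : Integrable (s'.indicator fun _ => M) μ := (integrable_const M).indicator hs'
  have hreal : μ.real s' ≤ p := by
    rw [measureReal_def, measure_toMeasurable]
    exact ENNReal.toReal_le_of_le_ofReal hp hs
  calc ∫ ω, f ω ∂μ ≤ ∫ ω, (c + s'.indicator (fun _ => M) ω) ∂μ := by
        refine integral_mono hf ((integrable_const c).add hint) fun ω => ?_
        by_cases hω : ω ∈ s'
        · simpa [Set.indicator_of_mem hω] using hbd ω
        · simpa [Set.indicator_of_notMem hω] using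
            hle ω fun h => hω (subset_toMeasurable μ s h)
    _ = c + M * μ.real s' := by
        rw [integral_add (integrable_const c) hint, integral_indicator_const _ hs']
        simp [mul_comm]
    _ ≤ _ := by gcongr

/-! ### The expected regret of the two phases. -/

section Regret
variable {d : ℕ} {Ω : Type*} {mΩ : MeasurableSpace Ω} {μ : Measure Ω} {ℱ : Filtration ℕ mΩ}
  {X : Set (Vec d)} {θ xstar : Vec d} {σ : ℝ} {T t₂ : ℕ} {arm : ℕ → Ω → Vec d}
  {reward : ℕ → Ω → ℝ} {Q : Set (Setoid (Fin d))} {ν : Measure (Vec d)}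
  {mhat : Ω → Submodule ℝ (Vec d)}

/-- The self-normalized bound on the selected model. -/
theorem measure_exists_mixture_mhat_ge_le [IsProbabilityMeasure μ] {lam : ℝ}
    (hI : IsInteraction μ ℱ X θ σ T arm reward)
    (hE : ExploresAndSelects μ ℱ Q ν t₂ arm reward mhat) (ht₂ : t₂ ≤ T) (hT : 0 < T)
    (hlam : 0 < lam) (hσ : 0 < σ) :
    μ {ω | ∃ t, t₂ ≤ t ∧ t ≤ T ∧ (T : ℝ) ≤ mixture (mhat ω) lam σ θ arm reward t₂ t ω} ≤
      ENNReal.ofReal (1 / T) := by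
  classical
  obtain ⟨hfin, -⟩ := finite_models_and_ncard_le (Q := Q)
  set P := hfin.toFinset
  set B : Submodule ℝ (Vec d) → Set Ω := fun m => {ω | mhat ω = m} ∩
    {ω | ∃ t, t₂ ≤ t ∧ t ≤ T ∧ (T : ℝ) ≤ mixture m lam σ θ arm reward t₂ t ω} with hB
  have hT' : (0 : ℝ) < T := by exact_mod_cast hT
  have hmeas : ∀ m, MeasurableSet {ω | mhat ω = m} := fun m => ℱ.le _ _ (hE.mhat_meas m)
  have hsub : {ω | ∃ t, t₂ ≤ t ∧ t ≤ T ∧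
      (T : ℝ) ≤ mixture (mhat ω) lam σ θ arm reward t₂ t ω} ⊆ ⋃ m ∈ P, B m := by
    intro ω hω
    have h : ω ∈ B (mhat ω) := by
      obtain ⟨t, h1, h2, h3⟩ := hω
      exact ⟨Eq.refl (mhat ω), t, h1, h2, h3⟩
    exact Set.mem_iUnion₂.2 ⟨mhat ω, hfin.mem_toFinset.2 (hE.mhat_selected ω).1, h⟩
  calc _ ≤ ∑ m ∈ P, μ (B m) := (measure_mono hsub).trans (measure_biUnion_finset_le _ _)
    _ ≤ ∑ m ∈ P, ENNReal.ofReal (1 / T) * μ {ω | mhat ω = m} := by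
        refine Finset.sum_le_sum fun m _ => ?_
        rw [one_div]
        -- The event that m is selected belongs to `ℱ t₂`, so the bound is proportional to its
        -- probability; summing over m costs no factor for the number of models.
        exact hI.measure_mixture_ge_le m hlam hσ ht₂ le_rfl hT' (hE.mhat_meas m)
    _ = ENNReal.ofReal (1 / T) * μ (⋃ m ∈ P, {ω | mhat ω = m}) := by
        rw [← Finset.mul_sum, measure_biUnion_finset _ fun m _ => hmeas m]
        intro m _ m' _ hne
        refine Set.disjoint_left.2 fun ω h h' => hne ?_
        exact (show mhat ω = m from h).symm.trans h'
    _ ≤ ENNReal.ofReal (1 / T) * 1 := by gcongr; exact prob_le_one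
    _ = _ := mul_one _

/-- Exploration costs 2R t₂, and the bad event costs 2RT · 2/T = 4R. The latter is absorbed because
(|κ| + 1)² E ≥ d₀ log T ≥ 1/2. -/
theorem regret_le [IsProbabilityMeasure μ] {A c κ c₂ K R ε lam S : ℝ} {d₀ : ℕ}
    {G : Subgroup (Equiv.Perm (Fin d))} (hd : 1 ≤ d) (hT : 2 ≤ T) (ht₂ : t₂ ≤ T) (hσ : 0 < σ)
    (hK : 1 ≤ K) (hR : 0 < R) (hε : 0 < ε) (hεκ : ε ≤ κ * σ) (hθ : θ ∈ fixedSubspace G)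
    (hG : orbitPartition G ∈ Q) (hQ : SubexponentialPartitions Q d₀ A c)
    (hB : BoundedArms X Q θ K R) (hsep : WellSeparated G θ ε) (hdist : IsDistOn X ν)
    (hν : 0 < lamMin (secondMoment ν)) (hx : xstar ∈ X)
    (hI : IsInteraction μ ℱ X θ σ T arm reward)
    (hE : ExploresAndSelects μ ℱ Q ν t₂ arm reward mhat)
    (hrate : exploreFactor A c κ * exploreRate σ K (lamMin (secondMoment ν)) ε d d₀ T ≤ t₂)
    (hlam : 0 < lam) (hS : ‖θ‖ ≤ S) (hlamS : √lam * S ≤ κ * σ)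
    (hlamR : σ ^ 2 * lamMin (secondMoment ν) ≤ κ * lam * R ^ 2)
    (hplay : PlaysOFUL X σ lam S (1 / (T : ℝ)) t₂ T arm reward mhat)
    (ht₂E : (t₂ : ℝ) ≤ c₂ * exploreRate σ K (lamMin (secondMoment ν)) ε d d₀ T) :
    regret μ θ xstar T arm ≤ (2 * |c₂| + (ofulFactor κ + 8) * (|κ| + 1) ^ 2 + ofulFactor κ) *
      (R * exploreRate σ K (lamMin (secondMoment ν)) ε d d₀ T +
        σ * (d₀ : ℝ) * √(T : ℝ) * Real.log (K * (T : ℝ))) := by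
  have hGm : fixedSubspace G ∈ models Q := ⟨G, hG, rfl⟩
  have hd₀ : 1 ≤ d₀ := (one_le_numClasses hd _).trans (hQ.1 _ hG)
  have hCK := lamMin_le_of_boundedArms hd hB hGm hdist hν
  obtain ⟨-, -, hρT, hDE⟩ := explore_bounds hd hT ht₂ hd₀ hσ hK hν hCK hε hεκ hrate
  have hbad₁ := measure_notMem_le hd hT ht₂ hσ hK hε hεκ hθ hG hQ hB hsep hdist hν hI hE hrate
  have hbad₂ := measure_exists_mixture_mhat_ge_le hI hE ht₂ (by omega) hlam hσ
  have hκ : 0 < κ := by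
    by_contra h
    push Not at h
    nlinarith
  have hd' : (1 : ℝ) ≤ d := by exact_mod_cast hd
  have hT' : (2 : ℝ) ≤ T := by exact_mod_cast hT
  have hd₀' : (1 : ℝ) ≤ d₀ := by exact_mod_cast hd₀
  have hLT : Real.log T ≤ Real.log (d * T) := Real.log_le_log (by linarith) (by nlinarith)
  have hLK : Real.log T ≤ Real.log (K * T) := Real.log_le_log (by linarith) (by nlinarith)
  have hlogT : 1 / 2 ≤ Real.log T := by
    have := Real.log_le_log (by norm_num) hT'
    linarith [Real.log_two_gt_d9]
  set E := exploreRate σ K (lamMin (secondMoment ν)) ε d d₀ T with hEdef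
  have hE0 : 0 ≤ E := by
    have : 0 ≤ Real.log (d * T) := by linarith
    rw [hEdef, exploreRate]; positivity
  set bound := ofulFactor κ * (R * (d₀ * Real.log T) + σ * d₀ * √(T : ℝ) * Real.log T) with hbound
  have hof := ofulFactor_pos κ
  have hbound0 : 0 ≤ bound := by positivity
  have hxR : ∀ t < T, ∀ ω, inner ℝ (xstar - arm t ω) θ ≤ 2 * R := by
    intro t ht ω
    have h1 := abs_le.1 (hB _ hx).2
    have h2 := abs_le.1 (hB _ (hI.arm_mem t ht ω)).2
    rw [inner_sub_left]
    linarith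
  set s : Set Ω := {ω | θ ∉ mhat ω} ∪
    {ω | ∃ t, t₂ ≤ t ∧ t ≤ T ∧ (T : ℝ) ≤ mixture (mhat ω) lam σ θ arm reward t₂ t ω} with hs
  have hs_le : μ s ≤ ENNReal.ofReal (2 / T) := by
    refine (measure_union_le _ _).trans ((add_le_add hbad₁ hbad₂).trans (le_of_eq ?_))
    rw [← ENNReal.ofReal_add (by positivity) (by positivity)]
    congr 1; ring
  have hexplore : ∀ ω, ∑ t ∈ Finset.range t₂, inner ℝ (xstar - arm t ω) θ ≤ 2 * R * t₂ := by
    intro ω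
    refine (Finset.sum_le_sum fun t ht =>
      hxR t ((Finset.mem_range.1 ht).trans_le ht₂) ω).trans (le_of_eq ?_)
    rw [Finset.sum_const, Finset.card_range, nsmul_eq_mul]; ring
  have hint : Integrable (fun ω => ∑ t ∈ Finset.range T, inner ℝ (xstar - arm t ω) θ) μ := by
    refine integrable_finsetSum _ fun t ht => ?_
    have ht' := Finset.mem_range.1 ht
    have hm : Measurable (arm t) := (hI.arm_meas t ht').mono (ℱ.le _) le_rfl
    refine (integrable_const (2 * R)).mono'
      (Measurable.aestronglyMeasurable (by fun_prop)) (ae_of_all _ fun ω => ?_)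
    have h1 := abs_le.1 (hB _ hx).2
    have h2 := abs_le.1 (hB _ (hI.arm_mem t ht' ω)).2
    rw [Real.norm_eq_abs, inner_sub_left, abs_le]
    constructor <;> linarith
  have hgood : ∀ ω ∉ s,
      ∑ t ∈ Finset.range T, inner ℝ (xstar - arm t ω) θ ≤ 2 * R * t₂ + bound := by
    intro ω hω
    simp only [hs, Set.mem_union, Set.mem_ofPred_eq, not_or, not_not, not_exists, not_and,
      not_le] at hω
    have hmem := (hE.mhat_selected ω).1
    have h1 := sum_regret_le_of_oful (τ := max 1 (R / σ / (T : ℝ) ^ 2)) hlam hσ (by omega) hR.le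
      (by linarith) (lt_of_lt_of_le one_pos (le_max_left _ _)) ht₂ hS hω.1 hx
      (finrank_le_of_mem_models hQ.1 hmem)
      (fun t ht => (hB _ (hI.arm_mem t ht ω)).1 _ (mem_extendedModels_of_mem_models hmem))
      (fun t ht => hxR t ht ω) hω.2 (fun t h1 h2 => hplay t h1 h2 ω)
    have h2 := oful_bound_le hκ hν (by linarith : 0 < K) hσ hlam hT' hρT hR hd₀' hlamS hlamR
    rw [← Finset.sum_range_add_sum_Ico _ ht₂]
    exact add_le_add (hexplore ω) (h1.trans h2)
  have hall : ∀ ω, ∑ t ∈ Finset.range T, inner ℝ (xstar - arm t ω) θ ≤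
      2 * R * t₂ + bound + 2 * R * T := by
    intro ω
    have h1 : ∑ t ∈ Finset.range T, inner ℝ (xstar - arm t ω) θ ≤ 2 * R * T := by
      refine (Finset.sum_le_sum fun t ht =>
        hxR t (Finset.mem_range.1 ht) ω).trans (le_of_eq ?_)
      rw [Finset.sum_const, Finset.card_range, nsmul_eq_mul]; ring
    have : 0 ≤ 2 * R * t₂ := by positivity
    linarith
  have hmain := integral_le_of_le_off hint (by positivity) hgood hall hs_le (by positivity)
  have h1 : 2 * R * T * (2 / (T : ℝ)) = 4 * R := by field_simp; norm_num
  rw [h1] at hmain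
  have hDlog : d₀ * Real.log T ≤ (|κ| + 1) ^ 2 * E := le_trans (by gcongr) hDE
  have h2 : 1 / 2 ≤ d₀ * Real.log T := by nlinarith
  have h3 : R ≤ 2 * ((|κ| + 1) ^ 2 * (R * E)) := by
    have : R * (1 / 2) ≤ R * ((|κ| + 1) ^ 2 * E) := by gcongr; linarith
    linarith
  have h4 : R * (t₂ : ℝ) ≤ |c₂| * (R * E) := by
    calc R * (t₂ : ℝ) ≤ R * (|c₂| * E) := by
          gcongr
          exact ht₂E.trans (by gcongr; exact le_abs_self c₂)
      _ = _ := by ring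
  have h5 : bound ≤ ofulFactor κ * ((|κ| + 1) ^ 2 * (R * E) +
      σ * d₀ * √(T : ℝ) * Real.log (K * T)) := by
    have h6 : R * (d₀ * Real.log T) ≤ (|κ| + 1) ^ 2 * (R * E) := by
      calc R * (d₀ * Real.log T) ≤ R * ((|κ| + 1) ^ 2 * E) := mul_le_mul_of_nonneg_left hDlog hR.le
        _ = _ := by ring
    rw [hbound]
    exact mul_le_mul_of_nonneg_left (add_le_add h6
      (mul_le_mul_of_nonneg_left hLK (by positivity))) hof.le
  have h6 : 0 ≤ σ * d₀ * √(T : ℝ) * Real.log (K * T) := by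
    have : 0 ≤ Real.log (K * T) := by linarith
    positivity
  have h7 : 0 ≤ R * E := by positivity
  rw [regret]
  refine hmain.trans ?_
  have h8 : 0 ≤ (2 * |c₂| + (ofulFactor κ + 8) * (|κ| + 1) ^ 2) *
      (σ * d₀ * √(T : ℝ) * Real.log (K * T)) := by positivity
  have h9 : 0 ≤ ofulFactor κ * (R * E) := by positivity
  linarith

end Regret

end SymBandit

end

/-! ### Assembly. -/

theorem theorem2 (A c κ : ℝ) :
    ∃ c₁ : ℝ, 0 < c₁ ∧ ∀ c₂ : ℝ, ∃ C : ℝ, 0 < C ∧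
      ∀ (d d₀ T t₂ : ℕ) (σ K R ε : ℝ) (X : Set (SymBandit.Vec d)) (θ xstar : SymBandit.Vec d)
        (Q : Set (Setoid (Fin d))) (G : Subgroup (Equiv.Perm (Fin d)))
        (ν : Measure (SymBandit.Vec d))
        (Ω : Type*) (mΩ : MeasurableSpace Ω) (μ : Measure Ω) (ℱ : Filtration ℕ mΩ)
        (arm : ℕ → Ω → SymBandit.Vec d) (reward : ℕ → Ω → ℝ)
        (mhat : Ω → Submodule ℝ (SymBandit.Vec d)),
        IsProbabilityMeasure μ →
        -- sizes and scales
        1 ≤ d → 2 ≤ T → t₂ ≤ T → 0 < σ → 1 ≤ K → 0 < R → 0 < ε → ε ≤ κ * σ →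
        -- the hidden symmetry and the assumptions on partitions, arms and separation
        θ ∈ SymBandit.fixedSubspace G →
        SymBandit.orbitPartition G ∈ Q →
        SymBandit.SubexponentialPartitions Q d₀ A c →
        SymBandit.BoundedArms X Q θ K R →
        SymBandit.WellSeparated G θ ε →
        -- the exploratory distribution, and a best arm
        SymBandit.IsExploratory X ν →
        0 < SymBandit.lamMin (SymBandit.secondMoment ν) →
        xstar ∈ X → (∀ x ∈ X, inner ℝ x θ ≤ inner ℝ xstar θ) →
        -- exploration and model selection
        SymBandit.IsInteraction μ ℱ X θ σ T arm reward →
        SymBandit.ExploresAndSelects μ ℱ Q ν t₂ arm reward mhat →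
        c₁ * SymBandit.exploreRate σ K (SymBandit.lamMin (SymBandit.secondMoment ν)) ε d d₀ T
          ≤ t₂ →
        1 - 1 / (T : ℝ) ≤ μ.real {ω | θ ∈ mhat ω} ∧
        -- OFUL on the selected model
        ∀ lam S : ℝ, 0 < lam → ‖θ‖ ≤ S → Real.sqrt lam * S ≤ κ * σ →
          σ ^ 2 * SymBandit.lamMin (SymBandit.secondMoment ν) ≤ κ * lam * R ^ 2 →
          SymBandit.PlaysOFUL X σ lam S (1 / (T : ℝ)) t₂ T arm reward mhat →
          (t₂ : ℝ) ≤ c₂ * SymBandit.exploreRate σ K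
            (SymBandit.lamMin (SymBandit.secondMoment ν)) ε d d₀ T →
          SymBandit.regret μ θ xstar T arm ≤
            C * (R * SymBandit.exploreRate σ K
                  (SymBandit.lamMin (SymBandit.secondMoment ν)) ε d d₀ T +
                σ * (d₀ : ℝ) * Real.sqrt (T : ℝ) * Real.log (K * (T : ℝ))) := by
  refine ⟨SymBandit.exploreFactor A c κ, SymBandit.exploreFactor_pos A c κ, fun c₂ =>
    ⟨2 * |c₂| + (SymBandit.ofulFactor κ + 8) * (|κ| + 1) ^ 2 + SymBandit.ofulFactor κ, ?_, ?_⟩⟩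
  · have := SymBandit.ofulFactor_pos κ
    positivity
  intro d d₀ T t₂ σ K R ε X θ xstar Q G ν Ω mΩ μ ℱ arm reward mhat hμ hd hT ht₂ hσ hK hR hε hεκ
    hθ hG hQ hB hsep hν hνpos hx _ hI hE hrate
  have hbad := SymBandit.measure_notMem_le hd hT ht₂ hσ hK hε hεκ hθ hG hQ hB hsep hν.1 hνpos hI hE
    hrate
  refine ⟨?_, fun lam S hlam hS hlamS hlamR hplay ht₂E => SymBandit.regret_le hd hT ht₂ hσ hK hR hε
    hεκ hθ hG hQ hB hsep hν.1 hνpos hx hI hE hrate hlam hS hlamS hlamR hplay ht₂E⟩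
  have h1 : μ.real {ω | θ ∉ mhat ω} ≤ 1 / T :=
    ENNReal.toReal_le_of_le_ofReal (by positivity) hbad
  -- Subadditivity gives the lower bound on the probability without measurability of the event.
  have h2 := measureReal_union_le (μ := μ) {ω | θ ∈ mhat ω} {ω | θ ∉ mhat ω}
  have h3 : {ω | θ ∈ mhat ω} ∪ {ω | θ ∉ mhat ω} = Set.univ := by
    ext ω
    simp [em]
  rw [h3, probReal_univ] at h2
  linarith
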